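/- Let $K$ be an algebraically closed field and $S=K[x_0,\dots,x_n]$ with $x_0<\dots<x_n$. For a monomial ideal $J\subseteq S$ let $B_J$ be its set of minimal monomial generators, $\mathcal N(J)$ the set of monomials not in $J$, $\mathcal N(J)_d$ those of degree $d$, and for $m\in\mathbb Z$ let $J_{\ge m}$ be the ideal of the elements of $J$ all of whose monomials have degree $\ge m$ (so $J_{\ge m}=J$ for $m\le 0$). For a monomial $x^\alpha$ let $x^{\underline\alpha}$ be the monomial obtained by putting $x_0=1$. $J$ is *strongly stable* if $x^\alpha\in J$, $x_i\mid x^\alpha$ and $i<j$ imply $x_jx^\alpha/x_i\in J$. For $J$ strongly stable let $\underline J$ be the ideal generated by the $x^{\underline\alpha}$ with $x^\alpha\in B_J$ (it is the saturation of $J$), and let $sB_J=\{x^\beta\in B_J : x^{\underline\beta}\in B_{\underline J}\}$ be the set of superminimal generators. Marked scheme: let $J$ be strongly stable, let $C=\{C_{\alpha\gamma}\}$ be variables indexed by $x^\alpha\in B_J$, $x^\gamma\in\mathcal N(J)_{|\alpha|}$, and let $F_\alpha=x^\alpha-\sum_\gamma C_{\alpha\gamma}x^\gamma\in K[C][x_0,\dots,x_n]$.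 Let $\mathcal V$ be the set of products $x^\delta F_\alpha$ such that $x^\delta=1$ or every variable dividing $x^\delta$ is $\le$ every variable dividing $x^\alpha$; the head term of $x^\delta F_\alpha$ is $x^{\delta+\alpha}$. A reduction step subtracts from a polynomial $h$ the product of $x^\delta F_\alpha\in\mathcal V$ and the nonzero coefficient in $h$ of $x^{\delta+\alpha}$. Let $\mathfrak A_J\subseteq K[C]$ be the ideal generated by the $x$-coefficients of all polynomials $h$ with $x$-support in $\mathcal N(J)$ that are obtained by finitely many reduction steps from an $S$-polynomial of two of the $F_\alpha$. The $J$-marked scheme is $\mathrm{Mf}(J)=\operatorname{Spec}K[C]/\mathfrak A_J$. Let $\widetilde C\subseteq C$ be the set of the variables $C_{\alpha\gamma}$ with $x^\alpha\in sB_J$. **Statement.** Let $\underline J\subseteq S$ be a saturated strongly stable monomial ideal, and let $\rho$ be the maximal degree of a monomial in $B_{\underline J}$ divisible by $x_1$ ($\rho=0$ if there is none). Let $\widetilde C^{[\rho-1]}$ be the set $\widetilde C$ for the ideal $\underline J_{\ge\rho-1}$. Then $sB_{\underline J_{\ge\rho-1}}$ and $\widetilde C^{[\rho-1]}$ are finite,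 and for every integer $m\ge\rho-1$ there is a closed immersion over $K$ of $\mathrm{Mf}(\underline J_{\ge m})$ into the affine space over $K$ of dimension $$|\widetilde C^{[\rho-1]}|=\sum_{x^\alpha\in sB_{\underline J_{\ge\rho-1}}}|\mathcal N(\underline J)_{|\alpha|}|.$$ Moreover $$|\widetilde C^{[\rho-1]}|\le |B_{\underline J}|\cdot p(r'),$$ where $p(t)\in\mathbb Q[t]$ is the Hilbert polynomial of $S/\underline J$ and $r'=\operatorname{reg}(\underline J)$ is the Castelnuovo–Mumford regularity, i.e. the smallest integer $r$ such that for all $i\ge 0$ the $i$-th syzygy module of $\underline J$ in its minimal graded free resolution is generated in degrees $\le r+i$ (for the zero ideal the regularity is not defined, and the last inequality is not claimed). -/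

import Mathlib

open AlgebraicGeometry CategoryTheory

universe u

noncomputable section

namespace MarkedFamily

/-- Exponents of the monomials of `K[x_0, …, x_n]`. -/
abbrev Mon (n : ℕ) : Type := Fin (n + 1) →₀ ℕ

/-- The polynomial ring `S = K[x_0, …, x_n]`. -/
abbrev PolyRing (n : ℕ) (K : Type u) [Field K] : Type u := MvPolynomial (Fin (n + 1)) K

section Monomials

variable {n : ℕ} {K : Type u} [Field K]

/-- The monomials lying in an ideal. -/
def monomials (J : Ideal (PolyRing n K)) : Set (Mon n) :=
  {a | MvPolynomial.monomial a (1 : K) ∈ J}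

/-- The sous-escalier `N(J)`: the monomials not lying in `J`. -/
def sousEscalier (J : Ideal (PolyRing n K)) : Set (Mon n) :=
  {a | MvPolynomial.monomial a (1 : K) ∉ J}

/-- The monomials of degree `d` in `N(J)`. -/
def sousEscalierDeg (J : Ideal (PolyRing n K)) (d : ℕ) : Set (Mon n) :=
  {a ∈ sousEscalier J | a.degree = d}

/-- The ideal generated by a set of monomials. -/
def monomialSpan (n : ℕ) (K : Type u) [Field K] (A : Set (Mon n)) : Ideal (PolyRing n K) :=
  Ideal.span ((fun a => MvPolynomial.monomial a (1 : K)) '' A)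

/-- `J` is a monomial ideal: it is generated by monomials. -/
def IsMonomialIdeal (J : Ideal (PolyRing n K)) : Prop :=
  ∃ A : Set (Mon n), J = monomialSpan n K A

/-- The monomial basis `B_J`: the monomials of `J` that are minimal for divisibility. -/
def monomialBasis (J : Ideal (PolyRing n K)) : Set (Mon n) :=
  {a | Minimal (· ∈ monomials J) a}

/-- `x^b` is obtained from `x^a` by an increasing elementary move:
`x^a x_j = x^b x_i` for some `i < j`. -/
def IncreasingMove (a b : Mon n) : Prop :=
  ∃ i j : Fin (n + 1), i < j ∧ a + Finsupp.single j 1 = b + Finsupp.single i 1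

/-- The Borel partial order: `BorelLT a b` means `x^b >_B x^a`. -/
def BorelLT (a b : Mon n) : Prop := Relation.TransGen IncreasingMove a b

/-- Strongly stable ideals (among monomial ideals). -/
def IsStronglyStable (J : Ideal (PolyRing n K)) : Prop :=
  ∀ a b : Mon n, a ∈ monomials J → BorelLT a b → b ∈ monomials J

/-- `I` is saturated: every `f` such that each variable has a power multiplying `f` into `I`
is in `I`. -/
def IsSaturated (I : Ideal (PolyRing n K)) : Prop :=
  ∀ f : PolyRing n K, (∀ j, ∃ r : ℕ, MvPolynomial.X j ^ r * f ∈ I) → f ∈ I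

/-- The truncation `J_{≥ m} = J ∩ S_{≥ m}`, for any integer `m`
(so that `J_{≥ m} = J` when `m ≤ 0`). -/
def truncation (J : Ideal (PolyRing n K)) (m : ℤ) : Ideal (PolyRing n K) :=
  J ⊓ monomialSpan n K {a | m ≤ (a.degree : ℤ)}

/-- The monomial obtained from `x^a` by putting `x_0 = 1`. -/
def underlineMon (a : Mon n) : Mon n := a.erase 0

/-- The ideal generated by the monomials obtained from `B_J` by putting `x_0 = 1`. -/
def underlineIdeal (J : Ideal (PolyRing n K)) : Ideal (PolyRing n K) :=
  monomialSpan n K (underlineMon '' monomialBasis J)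

/-- The set `sB_J` of superminimal generators of `J`. -/
def superminimals (J : Ideal (PolyRing n K)) : Set (Mon n) :=
  {a ∈ monomialBasis J | underlineMon a ∈ monomialBasis (underlineIdeal J)}

/-- The maximal degree of a monomial of `B_J` divisible by `x_1`
(it is `0` if there is no such monomial). -/
def rho (J : Ideal (PolyRing n K)) : ℕ :=
  sSup {d | ∃ a ∈ monomialBasis J, (∃ i : Fin (n + 1), (i : ℕ) = 1 ∧ a i ≠ 0) ∧ a.degree = d}

end Monomials

section Scheme

variable {n : ℕ} {K : Type u} [Field K]

/-- The index set of the parameters `C_{a c}`: `x^a ∈ B_J` and `x^c ∈ N(J)` of degree `|a|`. -/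
abbrev Param (J : Ideal (PolyRing n K)) : Type :=
  {p : Mon n × Mon n // p.1 ∈ monomialBasis J ∧ p.2 ∈ sousEscalierDeg J p.1.degree}

/-- The parameters appearing in the tails of the superminimals, i.e. those `C_{a c}`
with `x^a ∈ sB_J`. -/
def smallParams (J : Ideal (PolyRing n K)) : Set (Param J) :=
  {p | p.1.1 ∈ superminimals J}

/-- The ring `K[C]`. -/
abbrev ParamRing (J : Ideal (PolyRing n K)) : Type u := MvPolynomial (Param J) K

/-- The ring `K[C][x]`. -/
abbrev ParamPoly (J : Ideal (PolyRing n K)) : Type u :=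
  MvPolynomial (Fin (n + 1)) (ParamRing J)

open Classical in
/-- The generic marked polynomial `F_a = x^a - ∑ C_{a c} x^c`, the sum being over the monomials
`x^c ∈ N(J)` of degree `|a|`. -/
def genericMarked (J : Ideal (PolyRing n K)) (a : monomialBasis J) : ParamPoly J :=
  MvPolynomial.monomial a.1 1 -
    ∑ c ∈ Finset.univ.finsuppAntidiag a.1.degree,
      if h : c ∈ sousEscalierDeg J a.1.degree then
        MvPolynomial.monomial c (MvPolynomial.X ⟨(a.1, c), a.2, h⟩ : ParamRing J)
      else 0

/-- `VStep J h h'`: a monomial of `h`, with nonzero coefficient, is rewritten by means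
of a polynomial `x^d F_a` of the set `V`, i.e. with `x^d = 1` or `max(x^d) ≤ min(x^a)`,
having that monomial as head term; the result is `h'`. -/
def VStep (J : Ideal (PolyRing n K)) (h h' : ParamPoly J) : Prop :=
  ∃ (a : monomialBasis J) (d : Mon n),
    (∀ i ∈ d.support, ∀ j ∈ a.1.support, i ≤ j) ∧
    MvPolynomial.coeff (d + a.1) h ≠ 0 ∧
    h' = h - MvPolynomial.monomial d (MvPolynomial.coeff (d + a.1) h) * genericMarked J a

/-- The reduction relation associated to `V`. -/
def VReduces (J : Ideal (PolyRing n K)) : ParamPoly J → ParamPoly J → Prop :=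
  Relation.ReflTransGen (VStep J)

/-- `h ∈ K[C][x]` is `J`-reduced: its support in the variables `x` is contained in `N(J)`. -/
def IsReduced (J : Ideal (PolyRing n K)) (h : ParamPoly J) : Prop :=
  ∀ c ∈ h.support, c ∈ sousEscalier J

/-- The `S`-polynomial of `F_a` and `F_b`. -/
def sPoly (J : Ideal (PolyRing n K)) (a b : monomialBasis J) : ParamPoly J :=
  MvPolynomial.monomial ((a.1 ⊔ b.1) - a.1) 1 * genericMarked J a -
    MvPolynomial.monomial ((a.1 ⊔ b.1) - b.1) 1 * genericMarked J b

/-- The ideal of `K[C]` generated by the `x`-coefficients of the `J`-reduced forms,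
obtained by the reduction relation, of the `S`-polynomials of the generic marked polynomials. -/
def markedIdeal (J : Ideal (PolyRing n K)) : Ideal (ParamRing J) :=
  Ideal.span {r | ∃ (a b : monomialBasis J) (h : ParamPoly J),
    VReduces J (sPoly J a b) h ∧ IsReduced J h ∧ ∃ c, r = MvPolynomial.coeff c h}

/-- The marked scheme `Mf(J)` of a strongly stable ideal `J`: the closed subscheme of the affine
space with coordinates `C` defined by `markedIdeal J`. -/
def markedScheme (J : Ideal (PolyRing n K)) : Scheme.{u} :=
  Spec (CommRingCat.of (ParamRing J ⧸ markedIdeal J))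

/-- The structure morphism of `Mf(J)` over the base field. -/
def markedSchemeHom (J : Ideal (PolyRing n K)) :
    markedScheme J ⟶ Spec (CommRingCat.of K) :=
  Spec.map (CommRingCat.ofHom (algebraMap K (ParamRing J ⧸ markedIdeal J)))

/-- The affine space of dimension `N` over `K`. -/
abbrev affineSpace (K : Type u) [Field K] (N : ℕ) : Scheme.{u} :=
  𝔸(ULift.{u} (Fin N); Spec (CommRingCat.of K))

/-- A scheme over `K` embeds in the affine space of dimension `N`: there is a closed immersion
over `K`. -/
def EmbedsInAffineSpace {X : Scheme.{u}} (f : X ⟶ Spec (CommRingCat.of K)) (N : ℕ) : Prop :=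
  ∃ e : X ⟶ affineSpace K N,
    IsClosedImmersion e ∧ e ≫ (affineSpace K N ↘ Spec (CommRingCat.of K)) = f

end Scheme

section Numerical

variable {n : ℕ} {K : Type u} [Field K]

/-- The Hilbert function of `S/I`: the dimension of the image of `S_t` in `S/I`. -/
def hilbertFunction (I : Ideal (PolyRing n K)) (t : ℕ) : ℕ :=
  Module.finrank K
    ((MvPolynomial.homogeneousSubmodule (Fin (n + 1)) K t).map
      (Ideal.Quotient.mkₐ K I).toLinearMap)

/-- `p` is the Hilbert polynomial of `S/I`. -/
def IsHilbertPolynomial (I : Ideal (PolyRing n K)) (p : Polynomial ℚ) : Prop :=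
  ∀ᶠ t : ℕ in Filter.atTop, (hilbertFunction I t : ℚ) = p.eval (t : ℚ)

/-- `f` is homogeneous of degree `e ∈ ℤ` (hence zero if `e < 0`). -/
def IsHomogeneousInt (f : PolyRing n K) (e : ℤ) : Prop :=
  ∀ a ∈ f.support, (a.degree : ℤ) = e

/-- A minimal graded free resolution `⋯ → F_1 → F_0 → I → 0`, where `F_i` is free with a basis
of `rank i` elements, of degrees `deg i j`. -/
structure IsMinimalResolution (I : Ideal (PolyRing n K)) (rank : ℕ → ℕ)
    (deg : ∀ i, Fin (rank i) → ℤ)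
    (ε : (Fin (rank 0) → PolyRing n K) →ₗ[PolyRing n K] PolyRing n K)
    (d : ∀ i, (Fin (rank (i + 1)) → PolyRing n K) →ₗ[PolyRing n K]
      (Fin (rank i) → PolyRing n K)) : Prop where
  range_eq : LinearMap.range ε = I
  exact_zero : Function.Exact (d 0) ε
  exact_succ : ∀ i, Function.Exact (d (i + 1)) (d i)
  homogeneous_aug : ∀ k, IsHomogeneousInt (ε (Pi.single k 1)) (deg 0 k)
  homogeneous : ∀ i j k, IsHomogeneousInt (d i (Pi.single k 1) j) (deg (i + 1) k - deg i j)
  minimal : ∀ i j k, MvPolynomial.constantCoeff (d i (Pi.single k 1) j) = 0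

/-- `I` is `m`-regular: for all `i ≥ 0` its `i`-th syzygy module is generated in
degree `≤ m + i`. -/
def IsRegular (I : Ideal (PolyRing n K)) (m : ℤ) : Prop :=
  ∃ (rank : ℕ → ℕ) (deg : ∀ i, Fin (rank i) → ℤ)
    (ε : (Fin (rank 0) → PolyRing n K) →ₗ[PolyRing n K] PolyRing n K)
    (d : ∀ i, (Fin (rank (i + 1)) → PolyRing n K) →ₗ[PolyRing n K]
      (Fin (rank i) → PolyRing n K)),
    IsMinimalResolution I rank deg ε d ∧ ∀ i j, deg i j ≤ m + i

/-- `r` is the regularity of `I`: the smallest integer `m` such that `I` is `m`-regular. -/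
def IsRegularity (I : Ideal (PolyRing n K)) (r : ℤ) : Prop :=
  IsLeast {m : ℤ | IsRegular I m} r

end Numerical

end MarkedFamily

end

/-! Let `J` be the saturated ideal, and let `f_a` denote the generic marked polynomials with
coefficients in the coordinate ring of `Mf(J_{≥m})`. These coefficients generate that ring over `K`,
so it suffices to find as many algebra generators as there are parameters in `smallParams` of
`J_{≥ρ-1}`; a surjection of `K`-algebras then gives the closed immersion.

Marked basis. Every monomial of a strongly stable ideal is uniquely `x^e x^b` with `x^b` a minimal
generator and every variable of `x^e` at most every variable of `x^b`. Rewriting with these products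
lowers the colex order of the cofactor `x^e`, so reduction terminates. In the quotient by
`markedIdeal` the reduced forms of the S-polynomials vanish, so a polynomial of the ideal `(f_a)`
supported outside the monomial ideal is zero (`eq_zero_of_mem_span_universalMarked`).

Superminimals suffice. After multiplication by a power of `x_0`, any monomial can be reduced with
superminimal polynomials alone. Since `J` is stable under division by `x_0`, uniqueness of reduced
forms puts every coefficient of every `f_a` in the subring generated by those of the superminimal
ones (`coeff_mem_of_superminimal`).

Bounding the degree. For `m` above `ρ-1`, a superminimal `x_0^{m-|b|} x^b` could a priori have many
more parameters. However, its tail is divisible by the power of `x_0` separating it from the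
superminimal of `J_{≥ρ-1}` over the same `x^b` (`le_apply_zero_of_coeff_ne_zero`), because `x_1`
carries monomials outside `J` of large enough degree to monomials outside `J`. So its nonzero tail
coefficients are indexed by parameters of `J_{≥ρ-1}`.

Numerical bound. Each superminimal contributes `|N(J)_d|` with `d ≤ reg J`. This number grows with
`d`, and at `d = reg J` it equals the Hilbert polynomial, since counting star decompositions shows
that the Hilbert function is polynomial from the largest generator degree on. -/

noncomputable section

namespace MarkedFamily

/-! ### Star decompositions in strongly stable ideals and the colex order on cofactors. -/

section Combinatorics

variable {n : ℕ} {K : Type u} [Field K]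

/-- Every variable of `x^e` is at most every variable of `x^a`. -/
def Star (e a : Mon n) : Prop := ∀ i ∈ e.support, ∀ j ∈ a.support, i ≤ j

theorem monomials_mono {J : Ideal (PolyRing n K)} {a b : Mon n} (ha : a ∈ monomials J)
    (hab : a ≤ b) : b ∈ monomials J := by
  obtain ⟨c, rfl⟩ := exists_add_of_le hab
  have h := J.mul_mem_left (MvPolynomial.monomial c (1 : K)) ha
  rwa [MvPolynomial.monomial_mul, one_mul, add_comm c a] at h

theorem exists_monomialBasis_le {J : Ideal (PolyRing n K)} {a : Mon n} (ha : a ∈ monomials J) :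
    ∃ b ∈ monomialBasis J, b ≤ a := by
  obtain ⟨b, hb, hm⟩ := exists_minimal_le_of_wellFoundedLT (· ∈ monomials J) a ha
  exact ⟨b, hm, hb⟩

theorem monomialBasis_eq_of_le {J : Ideal (PolyRing n K)} {a b : Mon n}
    (ha : a ∈ monomials J) (hb : b ∈ monomialBasis J) (h : a ≤ b) : a = b :=
  le_antisymm h (hb.2 ha h)

theorem IsStronglyStable.move {J : Ideal (PolyRing n K)} (hJ : IsStronglyStable J) {a b : Mon n}
    {i j : Fin (n + 1)} (ha : a ∈ monomials J) (hij : i ≤ j)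
    (h : a + Finsupp.single j 1 = b + Finsupp.single i 1) : b ∈ monomials J := by
  rcases hij.eq_or_lt with rfl | hlt
  · rwa [← add_right_cancel h]
  · exact hJ a b ha (Relation.TransGen.single ⟨i, j, hlt, h⟩)

theorem single_le_of_ne {a : Mon n} {i : Fin (n + 1)} (h : a i ≠ 0) : Finsupp.single i 1 ≤ a := by
  classical
  intro k
  rw [Finsupp.single_apply]
  split_ifs with hk
  · subst hk; omega
  · exact Nat.zero_le _

/-- Look at the largest index `i` where `d` and `e` differ: there `d i < e i`, so `x_i` divides
`x^e` and `x^a` involves only variables from `x_i` on. Below `i` there is nothing to check, at `i`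
the deficit of `d` is made up by `c`, and above `i` the exponents of `a` and `c` agree. -/
theorem Star.le_of_not_lt {d c e a : Mon n} (hs : Star e a) (h : d + c = e + a)
    (hlt : ¬ toColex e < toColex d) : a ≤ c := by
  rcases (not_lt.1 hlt).eq_or_lt with heq | hlt
  · have : d = e := heq
    subst this
    exact (add_left_cancel h).ge
  · obtain ⟨i, hi, hlt⟩ := Finsupp.Colex.lt_iff.1 hlt
    replace hi : ∀ j, i < j → d j = e j := hi
    replace hlt : d i < e i := hlt
    intro k
    have hk : d k + c k = e k + a k := DFunLike.congr_fun h k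
    rcases lt_trichotomy k i with hki | rfl | hki
    · by_contra hne
      have : i ≤ k := hs i (by simp; omega) k (by simp; omega)
      omega
    · omega
    · have := hi k hki; omega

/-- The source of termination: when `x^d` times a tail monomial falls back into `J`, its star
cofactor is strictly below `x^d`. -/
theorem Star.cofactor_lt {J : Ideal (PolyRing n K)} {d c e a : Mon n} (hs : Star e a)
    (ha : a ∈ monomials J) (hc : c ∉ monomials J) (h : d + c = e + a) :
    toColex e < toColex d := by
  by_contra hlt
  exact hc (monomials_mono ha (hs.le_of_not_lt h hlt))

theorem Star.unique {J : Ideal (PolyRing n K)} {e a e' a' : Mon n} (hs : Star e a)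
    (hs' : Star e' a') (ha : a ∈ monomialBasis J) (ha' : a' ∈ monomialBasis J)
    (h : e + a = e' + a') : e = e' ∧ a = a' := by
  have : a = a' := by
    by_cases hlt : toColex e' < toColex e
    · exact monomialBasis_eq_of_le ha.1 ha' (hs.le_of_not_lt h.symm hlt.asymm)
    · exact (monomialBasis_eq_of_le ha'.1 ha (hs'.le_of_not_lt h hlt)).symm
  subst this
  exact ⟨add_right_cancel h, rfl⟩

/-- Otherwise `x^b` divides `x^a`, hence equals it, and the cofactor `x_j` would be admissible for
`x^a`. This gives the initial colex bound for reducing an S-polynomial. -/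
theorem Star.cofactor_lt_single {J : Ideal (PolyRing n K)} {e a b : Mon n} {j : Fin (n + 1)}
    (hs : Star e b) (ha : a ∈ monomialBasis J) (hb : b ∈ monomialBasis J)
    (hj : ¬ Star (Finsupp.single j 1) a) (h : Finsupp.single j 1 + a = e + b) :
    toColex e < toColex (Finsupp.single j 1) := by
  by_contra hlt
  have hba := monomialBasis_eq_of_le hb.1 ha (hs.le_of_not_lt h hlt)
  subst hba
  rw [add_right_cancel h] at hj
  exact hj hs

theorem degree_tsub_single {a : Mon n} {i : Fin (n + 1)} (h : a i ≠ 0) :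
    (a - Finsupp.single i 1).degree + 1 = a.degree := by
  conv_rhs => rw [← tsub_add_cancel_of_le (single_le_of_ne h)]
  simp

/-- Existence of the star decomposition in a strongly stable ideal. -/
theorem IsStronglyStable.exists_star {J : Ideal (PolyRing n K)} (hJ : IsStronglyStable J)
    {a : Mon n} (ha : a ∈ monomials J) :
    ∃ b ∈ monomialBasis J, ∃ e, Star e b ∧ e + b = a := by
  induction hd : a.degree using Nat.strong_induction_on generalizing a with
  | _ D ih =>
  subst hd
  by_cases hB : a ∈ monomialBasis J
  · exact ⟨a, hB, 0, by simp [Star], zero_add a⟩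
  obtain ⟨b, hb, hba⟩ := exists_monomialBasis_le ha
  have hne : b ≠ a := by rintro rfl; exact hB hb
  obtain ⟨i, hi⟩ : ∃ i, b i < a i := by
    by_contra! hcon
    exact hne (le_antisymm hba hcon)
  have hai : a i ≠ 0 := by omega
  have hsupp : a.support.Nonempty := ⟨i, by simpa using hai⟩
  -- Dividing by `x_i` stays in `J`, and an increasing move turns this into division by the smallest
  -- variable `x_k`. Multiplying back by `x_k` then preserves the star condition.
  set k := a.support.min' hsupp with hk
  have hak : a k ≠ 0 := by simpa using a.support.min'_mem hsupp
  have hki : k ≤ i := a.support.min'_le i (by simpa using hai)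
  have h1 : a - Finsupp.single i 1 ∈ monomials J := by
    refine monomials_mono hb.1 fun l => ?_
    have := hba l
    rw [Finsupp.tsub_apply, Finsupp.single_apply]
    split_ifs with h
    · subst h; omega
    · simpa using this
  have h2 : a - Finsupp.single k 1 ∈ monomials J := by
    refine hJ.move h1 hki ?_
    rw [tsub_add_cancel_of_le (single_le_of_ne hai), tsub_add_cancel_of_le (single_le_of_ne hak)]
  obtain ⟨b', hb', e, hs, he⟩ := ih _ (by have := degree_tsub_single hak; omega) h2 rfl
  have hsum : e + Finsupp.single k 1 + b' = a := by
    rw [add_right_comm, he, tsub_add_cancel_of_le (single_le_of_ne hak)]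
  refine ⟨b', hb', e + Finsupp.single k 1, ?_, hsum⟩
  intro l hl j hj
  have hl' : l ∈ e.support ∨ l = k := by
    by_contra! hcon
    simp only [Finsupp.mem_support_iff, Finsupp.add_apply, ne_eq, not_not] at hl hcon
    rw [hcon.1, Finsupp.single_apply, if_neg (Ne.symm hcon.2)] at hl
    exact hl rfl
  rcases hl' with hl' | rfl
  · exact hs l hl' j hj
  · refine a.support.min'_le j ?_
    rw [← hsum]
    simp only [Finsupp.mem_support_iff, Finsupp.add_apply] at hj ⊢
    omega

theorem exists_add_of_single_not_star {d a : Mon n} (h : ¬ Star d a) :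
    ∃ j d', d = d' + Finsupp.single j 1 ∧ ¬ Star (Finsupp.single j 1) a := by
  simp only [Star, not_forall] at h
  obtain ⟨j, hj, k, hk, hjk⟩ := h
  refine ⟨j, d - Finsupp.single j 1,
    (tsub_add_cancel_of_le (single_le_of_ne (by simpa using hj))).symm, fun hs => ?_⟩
  exact hjk (hs j (by simp) k hk)

end Combinatorics

/-! ### Marked sets over an arbitrary ring and the criterion for being a marked basis. -/

section MarkedSets

variable {n : ℕ} {K : Type u} [Field K] {A : Type*} [CommRing A]

/-- A marked set over `Q`: polynomials `f_a = x^a - (tail)`, one for each `x^a ∈ B_Q`, whose tail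
is supported on the monomials of `N(Q)` of degree `|a|`. -/
structure IsMarkedSet (Q : Ideal (PolyRing n K))
    (f : monomialBasis Q → MvPolynomial (Fin (n + 1)) A) : Prop where
  coeff_head : ∀ a, MvPolynomial.coeff a.1 (f a) = 1
  coeff_tail : ∀ a c, c ≠ a.1 → MvPolynomial.coeff c (f a) ≠ 0 → c ∈ sousEscalierDeg Q a.1.degree

/-- The span of the products `x^d f_b` with `max(x^d) ≤ min(x^b)` and `x^d` smaller than `x^e` in
the colexicographic order. -/
def starSpan {Q : Ideal (PolyRing n K)} (f : monomialBasis Q → MvPolynomial (Fin (n + 1)) A)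
    (e : Mon n) : Submodule A (MvPolynomial (Fin (n + 1)) A) :=
  Submodule.span A {p | ∃ b d, Star d b.1 ∧ toColex d < toColex e ∧
    p = MvPolynomial.monomial d 1 * f b}

theorem starSpan_mono {Q : Ideal (PolyRing n K)} (f : monomialBasis Q → MvPolynomial (Fin (n + 1)) A)
    {e e' : Mon n} (h : toColex e ≤ toColex e') : starSpan f e ≤ starSpan f e' :=
  Submodule.span_mono fun _ ⟨b, d, h1, h2, h3⟩ => ⟨b, d, h1, h2.trans_le h, h3⟩

theorem monomial_mul_mem_starSpan {Q : Ideal (PolyRing n K)}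
    (f : monomialBasis Q → MvPolynomial (Fin (n + 1)) A) {e d : Mon n} {b : monomialBasis Q}
    (hs : Star d b.1) (h : toColex d < toColex e) (r : A) :
    MvPolynomial.monomial d r * f b ∈ starSpan f e := by
  have : MvPolynomial.monomial d r * f b = r • (MvPolynomial.monomial d 1 * f b) := by
    rw [← smul_mul_assoc, MvPolynomial.smul_monomial, smul_eq_mul, mul_one]
  rw [this]
  exact Submodule.smul_mem _ _ (Submodule.subset_span ⟨b, d, hs, h, rfl⟩)

namespace IsMarkedSet

variable {Q : Ideal (PolyRing n K)} {f : monomialBasis Q → MvPolynomial (Fin (n + 1)) A}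

theorem coeff_monomial_mul_head (hf : IsMarkedSet Q f) (d : Mon n) (r : A) (a : monomialBasis Q) :
    MvPolynomial.coeff (d + a.1) (MvPolynomial.monomial d r * f a) = r := by
  rw [MvPolynomial.coeff_monomial_mul, hf.coeff_head, mul_one]

theorem eq_or_of_coeff_ne_zero (hf : IsMarkedSet Q f) {d c : Mon n} {r : A} {a : monomialBasis Q}
    (h : MvPolynomial.coeff c (MvPolynomial.monomial d r * f a) ≠ 0) :
    c = d + a.1 ∨ ∃ c' ∉ monomials Q, c = d + c' := by
  rw [MvPolynomial.coeff_monomial_mul'] at h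
  split_ifs at h with hd
  · obtain ⟨c', rfl⟩ := exists_add_of_le hd
    rw [add_tsub_cancel_left] at h
    by_cases hc : c' = a.1
    · left; rw [hc]
    · exact Or.inr ⟨c', (hf.coeff_tail a c' hc (right_ne_zero_of_mul h)).1, rfl⟩
  · exact absurd rfl h

/-- Colex induction on `x^d`: if the product is not a star product, some variable `x_j` of `x^d` is
inadmissible. Replacing `x_j f_a` by smaller star products makes all cofactors drop below `x^d`. -/
theorem monomial_mul_mem_span (hf : ∀ (a : monomialBasis Q) (j : Fin (n + 1)),
      ¬ Star (Finsupp.single j 1) a.1 →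
      MvPolynomial.monomial (Finsupp.single j 1) 1 * f a ∈ starSpan f (Finsupp.single j 1))
    (d : Mon n) (a : monomialBasis Q) :
    MvPolynomial.monomial d 1 * f a ∈ Submodule.span A
      (Set.range fun p : {p : Mon n × monomialBasis Q // Star p.1 p.2.1} =>
        MvPolynomial.monomial p.1.1 1 * f p.1.2) := by
  suffices H : ∀ (D : Colex (Mon n)) (a : monomialBasis Q),
      MvPolynomial.monomial (ofColex D) 1 * f a ∈ Submodule.span A
      (Set.range fun p : {p : Mon n × monomialBasis Q // Star p.1 p.2.1} =>
        MvPolynomial.monomial p.1.1 1 * f p.1.2) from H (toColex d) a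
  intro D
  induction D using WellFoundedLT.induction with
  | _ D ih =>
  intro a
  by_cases hs : Star (ofColex D) a.1
  · exact Submodule.subset_span ⟨⟨(ofColex D, a), hs⟩, rfl⟩
  obtain ⟨j, d', hd, hj⟩ := exists_add_of_single_not_star hs
  have key : ∀ p ∈ starSpan f (Finsupp.single j 1),
      MvPolynomial.monomial d' 1 * p ∈ Submodule.span A
      (Set.range fun p : {p : Mon n × monomialBasis Q // Star p.1 p.2.1} =>
        MvPolynomial.monomial p.1.1 1 * f p.1.2) := by
    intro p hp
    induction hp using Submodule.span_induction with
    | mem p hp =>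
      obtain ⟨b, e, -, he, rfl⟩ := hp
      rw [← mul_assoc, MvPolynomial.monomial_mul, one_mul]
      have : toColex (d' + e) < D := by
        have := add_lt_add_right he (toColex d')
        rw [← toColex_add, ← toColex_add, ← hd] at this
        exact this
      exact ih _ this b
    | zero => rw [mul_zero]; exact Submodule.zero_mem _
    | add x y _ _ hx hy => rw [mul_add]; exact Submodule.add_mem _ hx hy
    | smul r x _ hx => rw [mul_smul_comm]; exact Submodule.smul_mem _ _ hx
  have := key _ (hf a j hj)
  rwa [← mul_assoc, MvPolynomial.monomial_mul, one_mul, ← hd] at this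

/-- A marked set satisfying the Buchberger-like criterion is a marked basis: no nonzero polynomial
of the ideal it generates is supported on `N(Q)`. -/
theorem eq_zero_of_mem_span (hm : IsMarkedSet Q f)
    (hf : ∀ (a : monomialBasis Q) (j : Fin (n + 1)), ¬ Star (Finsupp.single j 1) a.1 →
      MvPolynomial.monomial (Finsupp.single j 1) 1 * f a ∈ starSpan f (Finsupp.single j 1))
    {h : MvPolynomial (Fin (n + 1)) A} (hI : h ∈ Ideal.span (Set.range f))
    (hN : ∀ c, MvPolynomial.coeff c h ≠ 0 → c ∉ monomials Q) : h = 0 := by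
  classical
  -- The ideal is already the `A`-span of the star products.
  have hV : h ∈ Submodule.span A
      (Set.range fun p : {p : Mon n × monomialBasis Q // Star p.1 p.2.1} =>
        MvPolynomial.monomial p.1.1 1 * f p.1.2) := by
    clear hN
    induction hI using Submodule.span_induction with
    | mem p hp =>
      obtain ⟨a, rfl⟩ := hp
      simpa using monomial_mul_mem_span hf 0 a
    | zero => exact Submodule.zero_mem _
    | add x y _ _ hx hy => exact Submodule.add_mem _ hx hy
    | smul g x hxI hx =>
      clear hxI
      rw [smul_eq_mul, MvPolynomial.as_sum g, Finset.sum_mul]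
      refine Submodule.sum_mem _ fun d _ => ?_
      have e1 : MvPolynomial.monomial d (MvPolynomial.coeff d g) * x =
          MvPolynomial.coeff d g • (MvPolynomial.monomial d 1 * x) := by
        rw [← smul_mul_assoc, MvPolynomial.smul_monomial, smul_eq_mul, mul_one]
      rw [e1]
      refine Submodule.smul_mem _ _ ?_
      clear e1
      induction hx using Submodule.span_induction with
      | mem p hp =>
        obtain ⟨⟨⟨e, a⟩, -⟩, rfl⟩ := hp
        dsimp only
        rw [← mul_assoc, MvPolynomial.monomial_mul, one_mul]
        exact monomial_mul_mem_span hf _ _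
      | zero => rw [mul_zero]; exact Submodule.zero_mem _
      | add x y _ _ hx hy => rw [mul_add]; exact Submodule.add_mem _ hx hy
      | smul r x _ hx => rw [mul_smul_comm]; exact Submodule.smul_mem _ _ hx
  obtain ⟨r, rfl⟩ := Finsupp.mem_span_range_iff_exists_finsupp.1 hV
  by_cases hr : r.support.Nonempty
  swap
  · rw [Finset.not_nonempty_iff_eq_empty, Finsupp.support_eq_empty] at hr
    simp [hr]
  -- The head of a star product with maximal cofactor cannot cancel: another star product has a
  -- different head, and one having this monomial in its tail would have a larger cofactor. So `h`
  -- has a monomial in `Q`.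
  obtain ⟨p, hp, hmax⟩ := Finset.exists_max_image r.support (fun p => toColex p.1.1) hr
  have hcoeff : MvPolynomial.coeff (p.1.1 + p.1.2.1)
      (r.sum fun i x => x • (MvPolynomial.monomial i.1.1 1 * f i.1.2)) = r p := by
    rw [Finsupp.sum, MvPolynomial.coeff_sum, Finset.sum_eq_single p]
    · rw [MvPolynomial.coeff_smul, hm.coeff_monomial_mul_head, smul_eq_mul, mul_one]
    · intro q hq hqp
      by_contra hne
      rw [MvPolynomial.coeff_smul, smul_eq_mul] at hne
      rcases hm.eq_or_of_coeff_ne_zero (right_ne_zero_of_mul hne) with heq | ⟨c, hc, heq⟩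
      · obtain ⟨h1, h2⟩ := p.2.unique q.2 p.1.2.2 q.1.2.2 heq
        exact hqp (Subtype.ext (Prod.ext h1.symm (Subtype.ext h2.symm)))
      · exact (hmax q hq).not_gt (p.2.cofactor_lt p.1.2.2.1 hc heq.symm)
    · intro hp'
      exact absurd hp hp'
  refine absurd (monomials_mono p.1.2.2.1 le_add_self) (hN (p.1.1 + p.1.2.1) ?_)
  rw [hcoeff]
  exact Finsupp.mem_support_iff.1 hp

theorem map {B : Type*} [CommRing B] (hf : IsMarkedSet Q f) (φ : A →+* B) :
    IsMarkedSet Q fun a => MvPolynomial.map φ (f a) where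
  coeff_head a := by rw [MvPolynomial.coeff_map, hf.coeff_head, map_one]
  coeff_tail a c hc h := by
    rw [MvPolynomial.coeff_map] at h
    exact hf.coeff_tail a c hc fun h0 => h (by rw [h0, map_zero])

end IsMarkedSet

theorem map_mem_starSpan {B : Type*} [CommRing B] (φ : A →+* B) {Q : Ideal (PolyRing n K)}
    {f : monomialBasis Q → MvPolynomial (Fin (n + 1)) A} {e : Mon n}
    {p : MvPolynomial (Fin (n + 1)) A} (hp : p ∈ starSpan f e) :
    MvPolynomial.map φ p ∈ starSpan (fun a => MvPolynomial.map φ (f a)) e := by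
  induction hp using Submodule.span_induction with
  | mem p hp =>
    obtain ⟨b, d, hs, hd, rfl⟩ := hp
    rw [map_mul, MvPolynomial.map_monomial, map_one]
    exact Submodule.subset_span ⟨b, d, hs, hd, rfl⟩
  | zero => rw [map_zero]; exact Submodule.zero_mem _
  | add x y _ _ hx hy => rw [map_add]; exact Submodule.add_mem _ hx hy
  | smul r x _ hx =>
    rw [MvPolynomial.smul_eq_C_mul, map_mul, MvPolynomial.map_C, ← MvPolynomial.smul_eq_C_mul]
    exact Submodule.smul_mem _ _ hx

end MarkedSets

/-! ### The generic marked set and the vanishing of S-polynomials over the marked scheme. -/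

section Generic

variable {n : ℕ} {K : Type u} [Field K] (J : Ideal (PolyRing n K))

open Classical in
theorem coeff_genericMarked (a : monomialBasis J) (c : Mon n) :
    MvPolynomial.coeff c (genericMarked J a) = (if a.1 = c then 1 else 0) -
      if h : c ∈ sousEscalierDeg J a.1.degree then
        (MvPolynomial.X ⟨(a.1, c), a.2, h⟩ : ParamRing J) else 0 := by
  rw [genericMarked, MvPolynomial.coeff_sub, MvPolynomial.coeff_monomial, MvPolynomial.coeff_sum]
  congr 1
  by_cases h : c ∈ sousEscalierDeg J a.1.degree
  · rw [Finset.sum_eq_single c, dif_pos h, MvPolynomial.coeff_monomial, if_pos rfl]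
    · rw [dif_pos h]
    · intro b _ hb
      split_ifs with h'
      · rw [MvPolynomial.coeff_monomial, if_neg hb]
      · rfl
    · intro hc
      refine absurd ?_ hc
      rw [Finset.mem_finsuppAntidiag]
      refine ⟨?_, Finset.subset_univ _⟩
      rw [← h.2, Finsupp.degree_eq_sum]
  · rw [dif_neg h]
    refine Finset.sum_eq_zero fun b _ => ?_
    split_ifs with h'
    · rw [MvPolynomial.coeff_monomial, if_neg]
      rintro rfl
      exact h h'
    · rfl

theorem isMarkedSet_genericMarked : IsMarkedSet J (genericMarked J) where
  coeff_head a := by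
    rw [coeff_genericMarked, if_pos rfl, dif_neg, sub_zero]
    exact fun h => h.1 a.2.1
  coeff_tail a c hc h := by
    rw [coeff_genericMarked, if_neg (Ne.symm hc)] at h
    by_contra hcon
    rw [dif_neg hcon, sub_zero] at h
    exact h rfl

variable {J}

-- Besides termination, this records that every cofactor used stays below `e`; that bound is what
-- the criterion for marked bases requires.
open Classical in
theorem exists_vReduces_isReduced (e : Mon n) (h : ParamPoly J)
    (he : ∀ c ∈ h.support, ∀ b ∈ monomialBasis J, ∀ d, Star d b → d + b = c →
      toColex d < toColex e) (hJ : IsStronglyStable J) :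
    ∃ h', VReduces J h h' ∧ IsReduced J h' ∧ h - h' ∈ starSpan (genericMarked J) e := by
  suffices H : ∀ (E : Colex (Mon n)) (h : ParamPoly J),
      (∀ c ∈ h.support, ∀ b ∈ monomialBasis J, ∀ d, Star d b → d + b = c → toColex d < E) →
      ∃ h', VReduces J h h' ∧ IsReduced J h' ∧ h - h' ∈ starSpan (genericMarked J) (ofColex E) from
    H (toColex e) h he
  clear he h e
  intro E
  induction E using WellFoundedLT.induction with
  | _ E ih =>
  -- Inner induction on the number of terms with cofactor exactly `x^e`, when this is the largest
  -- one allowed. Rewriting one such term creates only terms with smaller cofactor or terms outside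
  -- `J`.
  have key : ∀ (e : Mon n), toColex e < E → ∀ (k : ℕ) (h : ParamPoly J),
      (h.support.filter fun c => ∃ b ∈ monomialBasis J, Star e b ∧ e + b = c).card ≤ k →
      (∀ c ∈ h.support, ∀ b ∈ monomialBasis J, ∀ d, Star d b → d + b = c →
        toColex d ≤ toColex e) →
      ∃ h', VReduces J h h' ∧ IsReduced J h' ∧
        h - h' ∈ starSpan (genericMarked J) (ofColex E) := by
    intro e he k
    induction k with
    | zero =>
      intro h hk hle
      rw [Nat.le_zero, Finset.card_eq_zero, Finset.filter_eq_empty_iff] at hk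
      -- No term with cofactor `x^e` is left, so the bound becomes strict and the outer induction
      -- applies with `e` in place of `E`.
      obtain ⟨h', h1, h2, h3⟩ := ih (toColex e) he h fun c hc b hb d hs hd => by
        refine (hle c hc b hb d hs hd).lt_of_ne fun heq => hk hc ?_
        have : d = e := heq
        subst this
        exact ⟨b, hb, hs, hd⟩
      exact ⟨h', h1, h2, starSpan_mono _ he.le h3⟩
    | succ k ihk =>
      intro h hk hle
      by_cases hex : ∃ b ∈ monomialBasis J, Star e b ∧ e + b ∈ h.support
      swap
      · push Not at hex
        refine ihk h ?_ hle
        rw [Finset.card_eq_zero.2, ]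
        · exact Nat.zero_le _
        rw [Finset.filter_eq_empty_iff]
        rintro c hc ⟨b, hb, hs, rfl⟩
        exact hex b hb hs hc
      obtain ⟨b, hb, hs, hbc⟩ := hex
      have hgm := isMarkedSet_genericMarked J
      set r := MvPolynomial.coeff (e + b) h with hr
      set h1 := h - MvPolynomial.monomial e r * genericMarked J ⟨b, hb⟩ with hh1
      have hstep : VStep J h h1 :=
        ⟨⟨b, hb⟩, e, hs, MvPolynomial.mem_support_iff.1 hbc, rfl⟩
      have hz : e + b ∉ h1.support := by
        rw [MvPolynomial.notMem_support_iff, hh1, MvPolynomial.coeff_sub,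
          hgm.coeff_monomial_mul_head e r ⟨b, hb⟩, sub_self]
      have hsupp : ∀ c ∈ h1.support, c ∈ h.support ∨ ∃ c' ∉ monomials J, c = e + c' := by
        intro c hc
        by_contra! hcon
        have hcb : c ≠ e + b := by rintro rfl; exact hz hc
        rw [MvPolynomial.mem_support_iff, hh1, MvPolynomial.coeff_sub,
          MvPolynomial.notMem_support_iff.1 hcon.1, zero_sub, neg_ne_zero] at hc
        rcases hgm.eq_or_of_coeff_ne_zero hc with hc | ⟨c', hc', hc⟩
        · exact hcb hc
        · exact hcon.2 c' hc' hc
      obtain ⟨h', h2, h3, h4⟩ := ihk h1 (by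
          refine Nat.le_of_lt_succ (lt_of_lt_of_le (Finset.card_lt_card ?_) hk)
          refine Finset.ssubset_iff_of_subset ?_ |>.2 ⟨e + b, ?_, ?_⟩
          · intro c hc
            rw [Finset.mem_filter] at hc ⊢
            refine ⟨(hsupp c hc.1).resolve_right ?_, hc.2⟩
            rintro ⟨c', hc', rfl⟩
            obtain ⟨b', hb', hs', hbb⟩ := hc.2
            exact (hs'.cofactor_lt hb'.1 hc' hbb.symm).ne rfl
          · exact Finset.mem_filter.2 ⟨hbc, b, hb, hs, rfl⟩
          · exact fun hmem => hz (Finset.mem_filter.1 hmem).1) (by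
          intro c hc b' hb' d hs' hd
          rcases hsupp c hc with hc | ⟨c', hc', rfl⟩
          · exact hle c hc b' hb' d hs' hd
          · exact (hs'.cofactor_lt hb'.1 hc' hd.symm).le)
      refine ⟨h', Relation.ReflTransGen.head hstep h2, h3, ?_⟩
      have : h - h' = MvPolynomial.monomial e r * genericMarked J ⟨b, hb⟩ + (h1 - h') := by
        rw [hh1]; ring
      rw [this]
      exact Submodule.add_mem _ (monomial_mul_mem_starSpan _ hs he r) h4
  intro h hlt
  by_cases hred : IsReduced J h
  · exact ⟨h, Relation.ReflTransGen.refl, hred, by rw [sub_self]; exact Submodule.zero_mem _⟩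
  have hcof : ∀ c : Mon n, ∃ d, (c ∈ monomials J → ∃ b ∈ monomialBasis J, Star d b ∧ d + b = c) := by
    intro c
    by_cases hc : c ∈ monomials J
    · obtain ⟨b, hb, d, hs, hd⟩ := hJ.exists_star hc
      exact ⟨d, fun _ => ⟨b, hb, hs, hd⟩⟩
    · exact ⟨0, fun h => absurd h hc⟩
  choose cof hcof using hcof
  simp only [IsReduced, not_forall] at hred
  obtain ⟨c₀, hc₀, hc₀'⟩ := hred
  obtain ⟨c, hc, hmax⟩ := Finset.exists_max_image (h.support.filter (· ∈ monomials J))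
    (fun c => toColex (cof c)) ⟨c₀, Finset.mem_filter.2 ⟨hc₀, not_not.1 hc₀'⟩⟩
  rw [Finset.mem_filter] at hc
  obtain ⟨b, hb, hs, hd⟩ := hcof c hc.2
  refine key (cof c) (hlt c hc.1 b hb _ hs hd) _ h le_rfl fun c' hc' b' hb' d' hs' hd' => ?_
  have hcJ : c' ∈ monomials J := hd' ▸ monomials_mono hb'.1 le_add_self
  obtain ⟨b'', hb'', hs'', hd''⟩ := hcof c' hcJ
  rw [(hs'.unique hs'' hb' hb'' (hd'.trans hd''.symm)).1]
  exact hmax c' (Finset.mem_filter.2 ⟨hc', hcJ⟩)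

/-- The exponent of `x_j` in `x^b` must exceed that in `x^a`, otherwise `x^b` would divide `x^a`.
Consequently the S-polynomial of this pair is `x_j f_a - x^e f_b`. -/
theorem sup_eq_add_of_star {a b e : Mon n} {j : Fin (n + 1)} (ha : a ∈ monomialBasis J)
    (hb : b ∈ monomialBasis J) (hs : Star e b) (hj : ¬ Star (Finsupp.single j 1) a)
    (h : Finsupp.single j 1 + a = e + b) : a ⊔ b = Finsupp.single j 1 + a := by
  refine le_antisymm (sup_le le_add_self (h ▸ le_add_self)) fun k => ?_
  have hk : (Finsupp.single j 1 + a : Mon n) k = (e + b) k := DFunLike.congr_fun h k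
  rw [Finsupp.sup_apply]
  by_cases hjk : j = k
  · subst hjk
    have hba : ¬ b ≤ a := by
      intro hba
      have := monomialBasis_eq_of_le hb.1 ha hba
      subst this
      rw [add_right_cancel h] at hj
      exact hj hs
    have hlt : a j < b j := by
      by_contra hcon
      refine hba fun i => ?_
      have hi : (Finsupp.single j 1 + a : Mon n) i = (e + b) i := DFunLike.congr_fun h i
      by_cases hij : j = i
      · subst hij; omega
      · simp only [Finsupp.add_apply, Finsupp.single_apply, if_neg hij] at hi
        omega
    simp only [Finsupp.add_apply, Finsupp.single_apply, if_true]
    omega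
  · simp only [Finsupp.add_apply, Finsupp.single_apply, if_neg hjk]
    omega

/-- The quotient of `K[C]` which is the coordinate ring of the marked scheme. -/
abbrev MarkedRing (J : Ideal (PolyRing n K)) : Type u := ParamRing J ⧸ markedIdeal J

/-- The universal marked set over the coordinate ring of the marked scheme. -/
def universalMarked (J : Ideal (PolyRing n K)) (a : monomialBasis J) :
    MvPolynomial (Fin (n + 1)) (MarkedRing J) :=
  MvPolynomial.map (Ideal.Quotient.mk (markedIdeal J)) (genericMarked J a)

theorem isMarkedSet_universalMarked : IsMarkedSet J (universalMarked J) :=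
  (isMarkedSet_genericMarked J).map _

/-- The two heads of the S-polynomial `x_j f_a - x^e f_b` cancel, so its terms inside `J` have star
cofactors below `x_j`. It reduces by small star products to a form that is zero over the quotient
ring. -/
theorem single_mul_universalMarked_mem (hJ : IsStronglyStable J) (a : monomialBasis J)
    (j : Fin (n + 1)) (hj : ¬ Star (Finsupp.single j 1) a.1) :
    MvPolynomial.monomial (Finsupp.single j 1) 1 * universalMarked J a ∈
      starSpan (universalMarked J) (Finsupp.single j 1) := by
  have hgm := isMarkedSet_genericMarked J
  obtain ⟨b, hb, e, hs, he⟩ := hJ.exists_star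
    (monomials_mono a.2.1 (le_add_self : a.1 ≤ Finsupp.single j 1 + a.1))
  have hlt := hs.cofactor_lt_single a.2 hb hj he.symm
  have hsup := sup_eq_add_of_star a.2 hb hs hj he.symm
  have hsP : sPoly J a ⟨b, hb⟩ = MvPolynomial.monomial (Finsupp.single j 1) 1 * genericMarked J a -
      MvPolynomial.monomial e 1 * genericMarked J ⟨b, hb⟩ := by
    rw [sPoly]
    dsimp only
    rw [hsup, add_tsub_cancel_right, ← he, add_tsub_cancel_right]
  obtain ⟨h', h1, h2, h3⟩ := exists_vReduces_isReduced (Finsupp.single j 1) (sPoly J a ⟨b, hb⟩) (by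
    intro c hc b' hb' d hs' hd
    have hcne : c ≠ Finsupp.single j 1 + a.1 := by
      rintro rfl
      rw [MvPolynomial.mem_support_iff, hsP, MvPolynomial.coeff_sub, hgm.coeff_monomial_mul_head,
        ← he, hgm.coeff_monomial_mul_head e 1 ⟨b, hb⟩, sub_self] at hc
      exact hc rfl
    have hor : MvPolynomial.coeff c
          (MvPolynomial.monomial (Finsupp.single j 1) 1 * genericMarked J a) ≠ 0 ∨
        MvPolynomial.coeff c (MvPolynomial.monomial e 1 * genericMarked J ⟨b, hb⟩) ≠ 0 := by
      by_contra! hcon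
      rw [MvPolynomial.mem_support_iff, hsP, MvPolynomial.coeff_sub, hcon.1, hcon.2, sub_self] at hc
      exact hc rfl
    rcases hor with h | h
    · rcases hgm.eq_or_of_coeff_ne_zero h with h | ⟨c', hc', h⟩
      · exact absurd h hcne
      · exact hs'.cofactor_lt hb'.1 hc' (h.symm.trans hd.symm)
    · rcases hgm.eq_or_of_coeff_ne_zero h with h | ⟨c', hc', h⟩
      · exact absurd (h.trans he) hcne
      · exact (hs'.cofactor_lt hb'.1 hc' (h.symm.trans hd.symm)).trans hlt) hJ
  have h0 : MvPolynomial.map (Ideal.Quotient.mk (markedIdeal J)) h' = 0 := by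
    ext c
    rw [MvPolynomial.coeff_map, MvPolynomial.coeff_zero, Ideal.Quotient.eq_zero_iff_mem]
    exact Ideal.subset_span ⟨a, ⟨b, hb⟩, h', h1, h2, c, rfl⟩
  have h4 := map_mem_starSpan (Ideal.Quotient.mk (markedIdeal J)) h3
  rw [map_sub, h0, sub_zero, hsP, map_sub, map_mul, map_mul, MvPolynomial.map_monomial,
    MvPolynomial.map_monomial, map_one] at h4
  have h5 := Submodule.add_mem _ h4
    (monomial_mul_mem_starSpan (universalMarked J) (b := ⟨b, hb⟩) hs hlt 1)
  convert h5 using 1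
  · rfl
  · exact (sub_add_cancel _ _).symm

/-- The universal marked set is a marked basis. -/
theorem eq_zero_of_mem_span_universalMarked (hJ : IsStronglyStable J)
    {h : MvPolynomial (Fin (n + 1)) (MarkedRing J)}
    (hI : h ∈ Ideal.span (Set.range (universalMarked J)))
    (hN : ∀ c, MvPolynomial.coeff c h ≠ 0 → c ∉ monomials J) : h = 0 :=
  isMarkedSet_universalMarked.eq_zero_of_mem_span
    (fun a j hj => single_mul_universalMarked_mem hJ a j hj) hI hN

end Generic

/-! ### Saturated strongly stable ideals, their truncations and their superminimals. -/

section Saturated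

variable {n : ℕ} {K : Type u} [Field K]

theorem monomialBasis_finite (J : Ideal (PolyRing n K)) : (monomialBasis J).Finite :=
  WellQuasiOrderedLE.finite_of_isAntichain fun _ ha _ hb hne h =>
    hne (monomialBasis_eq_of_le ha.1 hb h)

theorem mem_monomials_monomialSpan {A : Set (Mon n)} {a : Mon n} :
    a ∈ monomials (monomialSpan n K A) ↔ ∃ b ∈ A, b ≤ a := by
  classical
  rw [monomials, Set.mem_ofPred_eq, monomialSpan, MvPolynomial.mem_ideal_span_monomial_image,
    MvPolynomial.support_monomial, if_neg one_ne_zero]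
  simp

theorem mem_monomials_truncation {J : Ideal (PolyRing n K)} {m : ℤ} {a : Mon n} :
    a ∈ monomials (truncation J m) ↔ a ∈ monomials J ∧ m ≤ (a.degree : ℤ) := by
  have h : a ∈ monomials (truncation J m) ↔ a ∈ monomials J ∧
      a ∈ monomials (monomialSpan n K {a : Mon n | m ≤ (a.degree : ℤ)}) := Iff.rfl
  rw [h, mem_monomials_monomialSpan]
  refine and_congr_right fun _ => ⟨?_, fun h => ⟨a, h, le_rfl⟩⟩
  rintro ⟨b, hb, hba⟩
  have hb' : m ≤ (b.degree : ℤ) := hb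
  have := Finsupp.degree_mono hba
  omega

theorem IsStronglyStable.truncation {J : Ideal (PolyRing n K)} (hJ : IsStronglyStable J) (m : ℤ) :
    IsStronglyStable (truncation J m) := by
  intro a b ha hab
  rw [mem_monomials_truncation] at ha ⊢
  refine ⟨hJ a b ha.1 hab, ?_⟩
  have hdeg : a.degree = b.degree := by
    induction hab with
    | single h =>
      obtain ⟨i, j, -, h⟩ := h
      simpa using congrArg Finsupp.degree h
    | tail _ h ih =>
      obtain ⟨i, j, -, h⟩ := h
      rw [ih]
      simpa using congrArg Finsupp.degree h
  rw [← hdeg]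
  exact ha.2

theorem eq_of_le_of_degree_le {a b : Mon n} (h : a ≤ b) (hd : b.degree ≤ a.degree) : a = b := by
  obtain ⟨c, rfl⟩ := exists_add_of_le h
  rw [map_add] at hd
  have : c.degree = 0 := by omega
  rw [Finsupp.degree_eq_zero_iff] at this
  rw [this, add_zero]

theorem mem_monomialBasis_truncation {J : Ideal (PolyRing n K)} {m : ℤ} {a : Mon n}
    (ha : a ∈ monomials J) (hd : (a.degree : ℤ) = m) : a ∈ monomialBasis (truncation J m) := by
  refine ⟨mem_monomials_truncation.2 ⟨ha, hd.ge⟩, fun c hc hca => ?_⟩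
  have := (mem_monomials_truncation.1 hc).2
  exact (eq_of_le_of_degree_le hca (by omega)).ge

/-- `J` is closed under division by `x_0`; strongly stable saturated ideals have this property. -/
theorem mem_of_single_add_mem {J : Ideal (PolyRing n K)} (hJ : IsStronglyStable J)
    (hs : IsSaturated J) {a : Mon n} {t : ℕ} (h : Finsupp.single 0 t + a ∈ monomials J) :
    a ∈ monomials J := by
  induction t with
  | zero => simpa using h
  | succ t ih =>
    -- If `x_0 x^c ∈ J`, increasing moves give `x_j x^c ∈ J` for every `j`, and saturation applies
    -- with all exponents equal to one.
    refine ih (hs _ fun j => ⟨1, ?_⟩)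
    rw [pow_one, MvPolynomial.X, MvPolynomial.monomial_mul, one_mul]
    refine hJ.move h (Fin.zero_le j) ?_
    rw [Finsupp.single_add]
    abel

theorem monomialBasis_apply_zero {J : Ideal (PolyRing n K)} (hJ : IsStronglyStable J)
    (hs : IsSaturated J) {b : Mon n} (hb : b ∈ monomialBasis J) : b 0 = 0 := by
  have h0 : Finsupp.single 0 (b 0) + b.erase 0 = b := Finsupp.single_add_erase 0 b
  have h1 : b.erase 0 ∈ monomials J := by
    apply mem_of_single_add_mem hJ hs (t := b 0)
    rw [h0]
    exact hb.1
  have h2 := hb.2 h1 (le_add_self.trans_eq h0) 0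
  simpa using h2

/-- The superminimal generator of `J_{≥ m}` corresponding to `x^b ∈ B_J`. -/
def superminimalOf (m : ℤ) (b : Mon n) : Mon n :=
  Finsupp.single 0 (m - (b.degree : ℤ)).toNat + b

theorem degree_superminimalOf (m : ℤ) (b : Mon n) :
    ((superminimalOf m b).degree : ℤ) = max m (b.degree : ℤ) := by
  rw [superminimalOf, map_add, Finsupp.degree_single]
  omega

theorem superminimalOf_mem {J : Ideal (PolyRing n K)} {b : Mon n} (hb : b ∈ monomialBasis J)
    (m : ℤ) : superminimalOf m b ∈ monomialBasis (truncation J m) := by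
  have hmem : superminimalOf m b ∈ monomials J := monomials_mono hb.1 le_add_self
  by_cases h : m ≤ (b.degree : ℤ)
  · have hz : superminimalOf m b = b := by
      rw [superminimalOf, Int.toNat_of_nonpos (by omega), Finsupp.single_zero, zero_add]
    rw [hz]
    exact ⟨mem_monomials_truncation.2 ⟨hb.1, h⟩, fun c hc hca =>
      hb.2 (mem_monomials_truncation.1 hc).1 hca⟩
  · exact mem_monomialBasis_truncation hmem (by rw [degree_superminimalOf]; omega)

theorem underlineMon_superminimalOf {b : Mon n} (hb : b 0 = 0) (m : ℤ) :
    underlineMon (superminimalOf m b) = b := by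
  classical
  ext i
  rw [underlineMon, superminimalOf, Finsupp.erase_apply]
  split_ifs with hi
  · rw [hi, hb]
  · simp [Ne.symm hi]

/-- Two monomials that differ only in the exponent of `x_0` are comparable for divisibility. -/
theorem eq_of_underlineMon_eq {J : Ideal (PolyRing n K)} {a b : Mon n} (ha : a ∈ monomialBasis J)
    (hb : b ∈ monomialBasis J) (h : underlineMon a = underlineMon b) : a = b := by
  have hi : ∀ i, i ≠ 0 → a i = b i := fun i hi => by
    have := DFunLike.congr_fun h i
    rwa [underlineMon, underlineMon, Finsupp.erase_ne hi, Finsupp.erase_ne hi] at this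
  rcases le_total (a 0) (b 0) with h0 | h0
  · refine monomialBasis_eq_of_le ha.1 hb fun i => ?_
    by_cases hi0 : i = 0
    · rwa [hi0]
    · exact (hi i hi0).le
  · refine (monomialBasis_eq_of_le hb.1 ha fun i => ?_).symm
    by_cases hi0 : i = 0
    · rwa [hi0]
    · exact (hi i hi0).ge

theorem IsMonomialIdeal.eq_monomialSpan {J : Ideal (PolyRing n K)} (hJ : IsMonomialIdeal J) :
    J = monomialSpan n K (monomialBasis J) := by
  refine le_antisymm ?_ ?_
  · obtain ⟨A, hA⟩ := hJ
    conv_lhs => rw [hA, monomialSpan]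
    rw [Ideal.span_le]
    rintro _ ⟨a, ha, rfl⟩
    have haJ : a ∈ monomials J := by
      rw [hA]; exact mem_monomials_monomialSpan.2 ⟨a, ha, le_rfl⟩
    exact mem_monomials_monomialSpan.2 (exists_monomialBasis_le haJ)
  · rw [monomialSpan, Ideal.span_le]
    rintro _ ⟨a, ha, rfl⟩
    exact ha.1

theorem underlineIdeal_truncation {J : Ideal (PolyRing n K)} (hm : IsMonomialIdeal J)
    (hJ : IsStronglyStable J) (hs : IsSaturated J) (m : ℤ) :
    underlineIdeal (truncation J m) = J := by
  refine le_antisymm ?_ ?_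
  · rw [underlineIdeal, monomialSpan, Ideal.span_le]
    rintro _ ⟨_, ⟨a, ha, rfl⟩, rfl⟩
    refine mem_of_single_add_mem hJ hs (t := a 0) ?_
    rw [underlineMon, Finsupp.single_add_erase]
    exact (mem_monomials_truncation.1 ha.1).1
  · conv_lhs => rw [hm.eq_monomialSpan]
    rw [monomialSpan, Ideal.span_le]
    rintro _ ⟨b, hb, rfl⟩
    exact mem_monomials_monomialSpan.2 ⟨b, ⟨_, superminimalOf_mem hb m,
      underlineMon_superminimalOf (monomialBasis_apply_zero hJ hs hb) m⟩, le_rfl⟩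

theorem superminimals_truncation {J : Ideal (PolyRing n K)} (hm : IsMonomialIdeal J)
    (hJ : IsStronglyStable J) (hs : IsSaturated J) (m : ℤ) :
    superminimals (truncation J m) = superminimalOf m '' monomialBasis J := by
  ext a
  rw [superminimals, underlineIdeal_truncation hm hJ hs]
  constructor
  · rintro ⟨ha, hu⟩
    refine ⟨_, hu, eq_of_underlineMon_eq (superminimalOf_mem hu m) ha ?_⟩
    exact underlineMon_superminimalOf (monomialBasis_apply_zero hJ hs hu) m
  · rintro ⟨b, hb, rfl⟩
    refine ⟨superminimalOf_mem hb m, ?_⟩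
    rwa [underlineMon_superminimalOf (monomialBasis_apply_zero hJ hs hb)]

theorem superminimalOf_injOn {J : Ideal (PolyRing n K)} (hJ : IsStronglyStable J)
    (hs : IsSaturated J) (m : ℤ) : Set.InjOn (superminimalOf m) (monomialBasis J) := by
  intro a ha b hb h
  rw [← underlineMon_superminimalOf (monomialBasis_apply_zero hJ hs ha) m,
    ← underlineMon_superminimalOf (monomialBasis_apply_zero hJ hs hb) m, h]

theorem degree_le_rho {J : Ideal (PolyRing n K)} {b : Mon n} (hb : b ∈ monomialBasis J)
    {i : Fin (n + 1)} (hi : (i : ℕ) = 1) (h : b i ≠ 0) : b.degree ≤ rho J := by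
  refine le_csSup ?_ ⟨b, hb, ⟨i, hi, h⟩, rfl⟩
  refine (((monomialBasis_finite J).image Finsupp.degree).subset ?_).bddAbove
  rintro _ ⟨a, ha, -, rfl⟩
  exact ⟨a, ha, rfl⟩

/-- Multiplication by `x_1` of a monomial outside `J` of large degree stays outside `J`. -/
theorem single_one_add_not_mem {J : Ideal (PolyRing n K)} (hJ : IsStronglyStable J)
    (hs : IsSaturated J) {c : Mon n} (hc : c ∉ monomials J) {i : Fin (n + 1)} (hi : (i : ℕ) = 1)
    (hd : rho J + c 0 ≤ c.degree) : Finsupp.single i 1 + c ∉ monomials J := by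
  classical
  intro hmem
  obtain ⟨b, hb, hle⟩ := exists_monomialBasis_le hmem
  have hb0 := monomialBasis_apply_zero hJ hs hb
  have hi0 : i ≠ 0 := by rintro rfl; simp at hi
  -- A generator not involving `x_1` would already divide `x^c`; hence `ρ` bounds the degree of
  -- `x^b`.
  have hbi : b i ≠ 0 := by
    intro hbi
    refine hc (monomials_mono hb.1 fun k => ?_)
    have := hle k
    by_cases hk : i = k
    · subst hk; omega
    · simpa [Finsupp.single_apply, hk] using this
  obtain ⟨e, he⟩ := exists_add_of_le hle
  have he0 : e 0 = c 0 := by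
    have := DFunLike.congr_fun he 0
    simp [hi0, hb0] at this
    exact this.symm
  have hdeg : e.degree ≥ c 0 + 1 := by
    have h1 := congrArg Finsupp.degree he
    have h2 := degree_le_rho hb hi hbi
    simp only [map_add, Finsupp.degree_single] at h1
    omega
  -- The quotient `x^e` has degree larger than its `x_0`-exponent, so it contains some `x_j` with `j
  -- ≥ 1`. Exchanging `x_1` for `x_j` in `x^b` gives a monomial of `J` dividing `x^c`.
  obtain ⟨j, hj0, hj⟩ : ∃ j, j ≠ 0 ∧ e j ≠ 0 := by
    by_contra! hcon
    have : e = Finsupp.single 0 (c 0) := by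
      ext k
      by_cases hk : k = 0
      · rw [hk, he0, Finsupp.single_eq_same]
      · rw [hcon k hk, Finsupp.single_apply, if_neg (Ne.symm hk)]
    rw [this, Finsupp.degree_single] at hdeg
    omega
  have hij : i ≤ j := by
    have : (j : ℕ) ≠ 0 := fun h => hj0 (Fin.ext h)
    rw [Fin.le_def]
    omega
  have hb' : b - Finsupp.single i 1 + Finsupp.single j 1 ∈ monomials J := by
    refine hJ.move hb.1 hij ?_
    rw [add_right_comm, tsub_add_cancel_of_le (single_le_of_ne hbi)]
  refine hc ?_
  have : c = b - Finsupp.single i 1 + Finsupp.single j 1 + (e - Finsupp.single j 1) := by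
    apply add_left_cancel (a := Finsupp.single i 1)
    rw [he, add_assoc, add_tsub_cancel_of_le (single_le_of_ne hj), ← add_assoc,
      add_tsub_cancel_of_le (single_le_of_ne hbi)]
  rw [this]
  exact monomials_mono hb' le_self_add

end Saturated

/-! ### Congruences modulo an ideal to polynomials with prescribed support. -/

section Reduction

variable {n : ℕ} {K : Type u} [Field K] {A : Type*} [CommRing A]

/-- Polynomials which, after multiplication by a power of `x_0`, are congruent modulo `I` to a
polynomial with coefficients in `B` supported on the set of monomials `N`. -/
def eventuallyReducible (I : Ideal (MvPolynomial (Fin (n + 1)) A)) (B : Subring A)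
    (N : Set (Mon n)) (hN : ∀ c ∈ N, ∀ t : ℕ, Finsupp.single 0 t + c ∈ N) :
    Submodule B (MvPolynomial (Fin (n + 1)) A) where
  carrier := {h | ∃ (t : ℕ) (h' : MvPolynomial (Fin (n + 1)) A),
    (∀ c, MvPolynomial.coeff c h' ∈ B) ∧ (∀ c, MvPolynomial.coeff c h' ≠ 0 → c ∈ N) ∧
    MvPolynomial.monomial (Finsupp.single 0 t) 1 * h - h' ∈ I}
  add_mem' := by
    rintro p q ⟨t, p', h1, h2, h3⟩ ⟨s, q', k1, k2, k3⟩
    -- Both congruences are brought to the common power `x_0^{t+s}`; `hN` keeps the supports in `N`.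
    refine ⟨t + s, MvPolynomial.monomial (Finsupp.single 0 s) 1 * p' +
      MvPolynomial.monomial (Finsupp.single 0 t) 1 * q', ?_, ?_, ?_⟩
    · intro c
      rw [MvPolynomial.coeff_add, MvPolynomial.coeff_monomial_mul',
        MvPolynomial.coeff_monomial_mul']
      refine B.add_mem ?_ ?_
      · split_ifs
        · rw [one_mul]; exact h1 _
        · exact B.zero_mem
      · split_ifs
        · rw [one_mul]; exact k1 _
        · exact B.zero_mem
    · intro c hc
      rw [MvPolynomial.coeff_add, MvPolynomial.coeff_monomial_mul',
        MvPolynomial.coeff_monomial_mul'] at hc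
      by_contra hcN
      apply hc
      have key : ∀ (r : ℕ) (g : MvPolynomial (Fin (n + 1)) A),
          (∀ c, MvPolynomial.coeff c g ≠ 0 → c ∈ N) →
          (if Finsupp.single 0 r ≤ c then 1 * MvPolynomial.coeff (c - Finsupp.single 0 r) g
            else 0) = 0 := by
        intro r g hg
        split_ifs with hle
        · by_contra hne
          rw [one_mul] at hne
          have := hN _ (hg _ hne) r
          rw [add_tsub_cancel_of_le hle] at this
          exact hcN this
        · rfl
      rw [key s p' h2, key t q' k2, add_zero]
    · have e1 : (MvPolynomial.monomial (Finsupp.single 0 (t + s)) 1 :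
          MvPolynomial (Fin (n + 1)) A) = MvPolynomial.monomial (Finsupp.single 0 t) 1 *
          MvPolynomial.monomial (Finsupp.single 0 s) 1 := by
        rw [MvPolynomial.monomial_mul, one_mul, Finsupp.single_add]
      have := I.add_mem (I.mul_mem_left (MvPolynomial.monomial (Finsupp.single 0 s) 1) h3)
        (I.mul_mem_left (MvPolynomial.monomial (Finsupp.single 0 t) 1) k3)
      rw [e1]
      convert this using 1
      ring
  zero_mem' := ⟨0, 0, fun c => by rw [MvPolynomial.coeff_zero]; exact B.zero_mem,
    fun c hc => absurd (MvPolynomial.coeff_zero c) hc, by simp⟩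
  smul_mem' := by
    rintro r p ⟨t, p', h1, h2, h3⟩
    refine ⟨t, (r : A) • p', fun c => ?_, fun c hc => ?_, ?_⟩
    · rw [MvPolynomial.coeff_smul]
      exact B.mul_mem r.2 (h1 c)
    · rw [MvPolynomial.coeff_smul] at hc
      exact h2 c (right_ne_zero_of_mul hc)
    · have : MvPolynomial.monomial (Finsupp.single 0 t) 1 * (r • p) - (r : A) • p' =
          MvPolynomial.C (r : A) * (MvPolynomial.monomial (Finsupp.single 0 t) 1 * p - p') := by
        rw [Subring.smul_def, MvPolynomial.smul_eq_C_mul, MvPolynomial.smul_eq_C_mul]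
        ring
      rw [this]
      exact I.mul_mem_left _ h3

/-- Polynomials congruent modulo `I` to a polynomial supported on `N`. -/
def reducible (I : Ideal (MvPolynomial (Fin (n + 1)) A)) (N : Set (Mon n)) :
    Submodule A (MvPolynomial (Fin (n + 1)) A) where
  carrier := {h | ∃ h' : MvPolynomial (Fin (n + 1)) A,
    (∀ c, MvPolynomial.coeff c h' ≠ 0 → c ∈ N) ∧ h - h' ∈ I}
  add_mem' := by
    rintro p q ⟨p', h2, h3⟩ ⟨q', k2, k3⟩
    refine ⟨p' + q', fun c hc => ?_, ?_⟩
    · rw [MvPolynomial.coeff_add] at hc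
      by_contra hcN
      apply hc
      rw [not_not.1 fun h => hcN (h2 c h), not_not.1 fun h => hcN (k2 c h), add_zero]
    · rw [add_sub_add_comm]
      exact I.add_mem h3 k3
  zero_mem' := ⟨0, fun c hc => absurd (MvPolynomial.coeff_zero c) hc, by simp⟩
  smul_mem' := by
    rintro r p ⟨p', h2, h3⟩
    refine ⟨r • p', fun c hc => ?_, ?_⟩
    · rw [MvPolynomial.coeff_smul] at hc
      exact h2 c (right_ne_zero_of_mul hc)
    · rw [← smul_sub, MvPolynomial.smul_eq_C_mul]
      exact I.mul_mem_left _ h3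

theorem mem_reducible_of_mem {I : Ideal (MvPolynomial (Fin (n + 1)) A)} {N : Set (Mon n)}
    {h : MvPolynomial (Fin (n + 1)) A} (hh : h ∈ I) : h ∈ reducible I N :=
  ⟨0, fun c hc => absurd (MvPolynomial.coeff_zero c) hc, by simpa using hh⟩

theorem mem_reducible_of_support {I : Ideal (MvPolynomial (Fin (n + 1)) A)} {N : Set (Mon n)}
    {h : MvPolynomial (Fin (n + 1)) A} (hh : ∀ c, MvPolynomial.coeff c h ≠ 0 → c ∈ N) :
    h ∈ reducible I N :=
  ⟨h, hh, by simp⟩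

theorem monomial_mul_mem_reducible {I : Ideal (MvPolynomial (Fin (n + 1)) A)} {N N' : Set (Mon n)}
    {h : MvPolynomial (Fin (n + 1)) A} (hh : h ∈ reducible I N) {d : Mon n}
    (hN : ∀ c ∈ N, d + c ∈ N') : MvPolynomial.monomial d 1 * h ∈ reducible I N' := by
  obtain ⟨h', h1, h2⟩ := hh
  refine ⟨MvPolynomial.monomial d 1 * h', fun c hc => ?_, ?_⟩
  · rw [MvPolynomial.coeff_monomial_mul'] at hc
    split_ifs at hc with hle
    · rw [one_mul] at hc
      have := hN _ (h1 _ hc)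
      rwa [add_tsub_cancel_of_le hle] at this
    · exact absurd rfl hc
  · rw [← mul_sub]
    exact I.mul_mem_left _ h2

/-- The tail of a marked polynomial is supported on `N(Q)` in the degree of its head term. -/
theorem IsMarkedSet.coeff_sub_ne_zero {Q : Ideal (PolyRing n K)}
    {f : monomialBasis Q → MvPolynomial (Fin (n + 1)) A} (hf : IsMarkedSet Q f)
    {a : monomialBasis Q} {c : Mon n}
    (hc : MvPolynomial.coeff c (MvPolynomial.monomial a.1 1 - f a) ≠ 0) :
    c ∈ sousEscalierDeg Q a.1.degree ∧
      MvPolynomial.coeff c (MvPolynomial.monomial a.1 1 - f a) = - MvPolynomial.coeff c (f a) := by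
  classical
  by_cases hca : c = a.1
  · subst hca
    rw [MvPolynomial.coeff_sub, hf.coeff_head, MvPolynomial.coeff_monomial, if_pos rfl,
      sub_self] at hc
    exact absurd rfl hc
  · rw [MvPolynomial.coeff_sub, MvPolynomial.coeff_monomial, if_neg (Ne.symm hca), zero_sub] at hc ⊢
    exact ⟨hf.coeff_tail a c hca (neg_ne_zero.1 hc), rfl⟩

end Reduction

/-! ### Marked bases over truncations: the role of the superminimals and divisibility by `x_0`. -/

section Truncation

variable {n : ℕ} {K : Type u} [Field K] {J : Ideal (PolyRing n K)} {m : ℤ}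
  {A : Type*} [CommRing A] {f : monomialBasis (truncation J m) → MvPolynomial (Fin (n + 1)) A}

theorem not_mem_of_mem_sousEscalierDeg_truncation {a c : Mon n}
    (ha : a ∈ monomialBasis (truncation J m)) (hc : c ∈ sousEscalierDeg (truncation J m) a.degree) :
    c ∉ monomials J := fun hcJ =>
  hc.1 (mem_monomials_truncation.2 ⟨hcJ, hc.2 ▸ (mem_monomials_truncation.1 ha.1).2⟩)

/-- Colex induction on the star cofactor with respect to `J` itself, not its truncation. Multiplying
`x^e x^b` by a power of `x_0` turns `x^b` into a superminimal, which may be replaced by its tail. -/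
theorem monomial_mem_eventuallyReducible (hJ : IsStronglyStable J)
    (hms : IsMarkedSet (truncation J m) f)
    (B : Subring A)
    (hN : ∀ c ∈ sousEscalier J, ∀ t : ℕ, Finsupp.single 0 t + c ∈ sousEscalier J)
    (hB : ∀ (b : Mon n) (hb : b ∈ monomialBasis J) (c : Mon n),
      MvPolynomial.coeff c
        (f ⟨superminimalOf m b, superminimalOf_mem hb m⟩) ∈ B)
    (a : Mon n) : MvPolynomial.monomial a 1 ∈
      eventuallyReducible (Ideal.span (Set.range f)) B
        (sousEscalier J) hN := by
  classical
  set I := Ideal.span (Set.range f)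
  have hout : ∀ c : Mon n, c ∉ monomials J →
      MvPolynomial.monomial c 1 ∈ eventuallyReducible I B (sousEscalier J) hN := by
    intro c hc
    refine ⟨0, MvPolynomial.monomial c 1, fun c' => ?_, fun c' hc' => ?_, ?_⟩
    · rw [MvPolynomial.coeff_monomial]
      split_ifs
      exacts [B.one_mem, B.zero_mem]
    · rw [MvPolynomial.coeff_monomial] at hc'
      split_ifs at hc' with h
      · exact h ▸ hc
      · exact absurd rfl hc'
    · simp
  suffices H : ∀ (E : Colex (Mon n)), ∀ b ∈ monomialBasis J, Star (ofColex E) b →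
      MvPolynomial.monomial (ofColex E + b) 1 ∈
        eventuallyReducible I B (sousEscalier J) hN by
    by_cases ha : a ∈ monomials J
    · obtain ⟨b, hb, e, hs, rfl⟩ := hJ.exists_star ha
      exact H (toColex e) b hb hs
    · exact hout a ha
  intro E
  induction E using WellFoundedLT.induction with
  | _ E ih =>
  intro b hb hs
  set e : Mon n := ofColex E with he
  set s : monomialBasis (truncation J m) := ⟨superminimalOf m b, superminimalOf_mem hb m⟩ with hsdef
  set τ := MvPolynomial.monomial s.1 1 - f s with hτ
  have hτE : MvPolynomial.monomial e 1 * τ ∈ eventuallyReducible I B (sousEscalier J) hN := by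
    rw [MvPolynomial.as_sum τ, Finset.mul_sum]
    refine Submodule.sum_mem _ fun c hc => ?_
    rw [MvPolynomial.mem_support_iff] at hc
    obtain ⟨h1, h2⟩ := hms.coeff_sub_ne_zero hc
    have hcB : MvPolynomial.coeff c τ ∈ B := by
      rw [hτ, h2]
      exact B.neg_mem (hB b hb c)
    have e1 : MvPolynomial.monomial e 1 * MvPolynomial.monomial c (MvPolynomial.coeff c τ) =
        (⟨_, hcB⟩ : B) • (MvPolynomial.monomial (e + c) 1 :
          MvPolynomial (Fin (n + 1)) A) := by
      rw [MvPolynomial.monomial_mul, one_mul, Subring.smul_def, MvPolynomial.smul_monomial,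
        smul_eq_mul, mul_one]
    rw [e1]
    refine Submodule.smul_mem _ _ ?_
    -- The tail monomial `x^c` lies outside `J`, so if `x^e x^c` is in `J` its cofactor is smaller
    -- than `x^e`.
    by_cases hcJ : e + c ∈ monomials J
    · obtain ⟨b', hb', e', hs', he'⟩ := hJ.exists_star hcJ
      rw [← he']
      exact ih (toColex e') (hs'.cofactor_lt hb'.1
        (not_mem_of_mem_sousEscalierDeg_truncation s.2 h1) he'.symm) b' hb' hs'
    · exact hout _ hcJ
  obtain ⟨t, h', h1, h2, h3⟩ := hτE
  refine ⟨t + (m - (b.degree : ℤ)).toNat, h', h1, h2, ?_⟩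
  have hfs : MvPolynomial.monomial (Finsupp.single 0 t) 1 * MvPolynomial.monomial e 1 *
      f s ∈ I :=
    I.mul_mem_left _ (Ideal.subset_span ⟨s, rfl⟩)
  have e2 : (MvPolynomial.monomial (Finsupp.single 0 (t + (m - (b.degree : ℤ)).toNat)) 1 *
      MvPolynomial.monomial (e + b) 1 :
        MvPolynomial (Fin (n + 1)) A) =
      MvPolynomial.monomial (Finsupp.single 0 t) 1 * MvPolynomial.monomial e 1 *
        MvPolynomial.monomial s.1 1 := by
    rw [MvPolynomial.monomial_mul, MvPolynomial.monomial_mul, MvPolynomial.monomial_mul, one_mul,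
      hsdef]
    dsimp only
    rw [superminimalOf, Finsupp.single_add]
    congr 1
    · congr 1
      abel
    · rw [one_mul]
  have := I.add_mem h3 hfs
  rw [e2]
  convert this using 1
  rw [hτ]
  ring

/-- The coefficients of the superminimal elements generate all the coefficients. -/
theorem coeff_mem_of_superminimal (hJ : IsStronglyStable J) (hs : IsSaturated J)
    (hms : IsMarkedSet (truncation J m) f)
    (hzero : ∀ h ∈ Ideal.span (Set.range f),
      (∀ c, MvPolynomial.coeff c h ≠ 0 → c ∉ monomials J) → h = 0)
    (B : Subring A)
    (hB : ∀ (b : Mon n) (hb : b ∈ monomialBasis J) (c : Mon n),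
      MvPolynomial.coeff c
        (f ⟨superminimalOf m b, superminimalOf_mem hb m⟩) ∈ B)
    (a : monomialBasis (truncation J m)) (c : Mon n) :
    MvPolynomial.coeff c (f a) ∈ B := by
  have hN : ∀ c ∈ sousEscalier J, ∀ t : ℕ, Finsupp.single 0 t + c ∈ sousEscalier J :=
    fun c hc t h => hc (mem_of_single_add_mem hJ hs h)
  set I := Ideal.span (Set.range f) with hI
  set τ := MvPolynomial.monomial a.1 1 - f a with hτ
  obtain ⟨t, h', h1, h2, h3⟩ := monomial_mem_eventuallyReducible hJ hms B hN hB a.1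
  have hfa : MvPolynomial.monomial (Finsupp.single 0 t) 1 * f a ∈ I :=
    I.mul_mem_left _ (Ideal.subset_span ⟨a, rfl⟩)
  have h4 : MvPolynomial.monomial (Finsupp.single 0 t) 1 * τ - h' ∈ I := by
    have := I.sub_mem h3 hfa
    convert this using 1
    rw [hτ]
    ring
  -- Both `x_0^t τ` and `h'` are supported outside `J`, so they are equal, and the coefficients of
  -- `τ` are coefficients of `h'`.
  have h5 := hzero _ h4 fun c hc => by
    by_cases hc' : MvPolynomial.coeff c h' = 0
    · rw [MvPolynomial.coeff_sub, hc', sub_zero, MvPolynomial.coeff_monomial_mul'] at hc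
      split_ifs at hc with hle
      · rw [one_mul] at hc
        have := hN _ (not_mem_of_mem_sousEscalierDeg_truncation a.2
          (hms.coeff_sub_ne_zero hc).1) t
        rwa [add_tsub_cancel_of_le hle] at this
      · exact absurd rfl hc
    · exact h2 c hc'
  by_cases hca : c = a.1
  · rw [hca, hms.coeff_head]
    exact B.one_mem
  by_cases hc0 : MvPolynomial.coeff c τ = 0
  · classical
    rw [hτ, MvPolynomial.coeff_sub, MvPolynomial.coeff_monomial, if_neg (Ne.symm hca), zero_sub,
      neg_eq_zero] at hc0
    rw [hc0]
    exact B.zero_mem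
  · have h6 := (hms.coeff_sub_ne_zero hc0).2
    rw [← neg_neg (MvPolynomial.coeff c (f a)), ← h6]
    refine B.neg_mem ?_
    have h7 : MvPolynomial.coeff c τ = MvPolynomial.coeff (Finsupp.single 0 t + c) h' := by
      rw [← sub_eq_zero.1 h5, MvPolynomial.coeff_monomial_mul, one_mul]
    have h8 : MvPolynomial.coeff c (MvPolynomial.monomial a.1 1 -
      f a) = MvPolynomial.coeff (Finsupp.single 0 t + c) h' := h7
    rw [h8]
    exact h1 _

/-- In degree `m`, the polynomial marked on a monomial divisible by `x_0^k` is divisible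
by `x_0^k`, as long as `m - k ≥ ρ - 1`. -/
theorem le_apply_zero_of_coeff_ne_zero (hJ : IsStronglyStable J) (hs : IsSaturated J)
    (hms : IsMarkedSet (truncation J m) f)
    (hzero : ∀ h ∈ Ideal.span (Set.range f),
      (∀ c, MvPolynomial.coeff c h ≠ 0 → c ∉ monomials J) → h = 0) (k : ℕ)
    (a : monomialBasis (truncation J m)) (hd : (a.1.degree : ℤ) = m) (hk : k ≤ a.1 0)
    (hrho : rho J + k ≤ a.1.degree + 1) (c : Mon n)
    (hc : MvPolynomial.coeff c (f a) ≠ 0) : k ≤ c 0 := by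
  classical
  induction k generalizing a c with
  | zero => exact Nat.zero_le _
  | succ k ih =>
  by_cases hca : c = a.1
  · rwa [hca]
  have hcN := hms.coeff_tail a c hca hc
  have hkc := ih a hd (by omega) (by omega) c hc
  by_contra hlt
  have hck : c 0 = k := by omega
  -- With a single variable there is no `x_1`, but a monomial is determined by its degree.
  by_cases hn : n = 0
  · subst hn
    refine hca (Finsupp.ext fun i => ?_)
    have h2 := hcN.2
    rw [Finsupp.degree_eq_sum, Finsupp.degree_eq_sum] at h2
    simp only [Fin.sum_univ_one, Nat.reduceAdd, Fin.isValue] at h2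
    have hi : i = 0 := Fin.ext (by omega)
    rw [hi]
    exact h2
  set I := Ideal.span (Set.range f) with hI
  let x₁ : Fin (n + 1) := ⟨1, by omega⟩
  have hx₁ : (x₁ : ℕ) = 1 := rfl
  have hx₁0 : x₁ ≠ 0 := fun h => by rw [h] at hx₁; simp at hx₁
  have hfI : ∀ a, f a ∈ I := fun a => Ideal.subset_span ⟨a, rfl⟩
  let N : ℕ → Set (Mon n) := fun k => {c | c ∉ monomials J ∧ k ≤ c 0}
  -- Monomials of degree `m` inside `J` are generators of the truncation, so the induction
  -- hypothesis makes their tails divisible by `x_0^k`.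
  have hmon : ∀ e : Mon n, e.degree = a.1.degree → k ≤ e 0 →
      MvPolynomial.monomial e 1 ∈ reducible I (N k) := by
    intro e he hek
    by_cases heJ : e ∈ monomials J
    · let b : monomialBasis (truncation J m) :=
        ⟨e, mem_monomialBasis_truncation heJ (by rw [he, hd])⟩
      have h1 : MvPolynomial.monomial e 1 - f b ∈
          reducible I (N k) := mem_reducible_of_support fun c hc => by
        have h2 := hms.coeff_sub_ne_zero (a := b) hc
        refine ⟨not_mem_of_mem_sousEscalierDeg_truncation b.2 h2.1, ?_⟩
        refine ih b (by change (e.degree : ℤ) = m; omega) hek ?_ c ?_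
        · change rho J + k ≤ e.degree + 1
          omega
        · intro h0
          exact hc (h2.2.trans (by rw [h0, neg_zero]))
      have := Submodule.add_mem _ h1 (mem_reducible_of_mem (hfI b))
      rwa [sub_add_cancel] at this
    · refine mem_reducible_of_support fun c hc => ?_
      rw [MvPolynomial.coeff_monomial] at hc
      split_ifs at hc with h
      · exact h ▸ ⟨heJ, hek⟩
      · exact absurd rfl hc
  -- Write `x_1 x^e = x_0 · (x_1 x^e / x_0)`: the second factor has degree `m` again, and the factor
  -- `x_0` raises the divisibility from `k` to `k + 1`.
  have hmon' : ∀ e : Mon n, e.degree = a.1.degree → k + 1 ≤ e 0 →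
      MvPolynomial.monomial (Finsupp.single x₁ 1 + e) 1 ∈ reducible I (N (k + 1)) := by
    intro e he hek
    have he0 : e 0 ≠ 0 := by omega
    have h1 := hmon (Finsupp.single x₁ 1 + (e - Finsupp.single 0 1))
      (by rw [map_add, Finsupp.degree_single]; have := degree_tsub_single he0; omega)
      (by simp [hx₁0]; omega)
    have h2 := monomial_mul_mem_reducible (N' := N (k + 1)) (d := Finsupp.single 0 1) h1
      fun c hc => ⟨fun h => hc.1 (mem_of_single_add_mem hJ hs h), by
        have := hc.2
        simp; omega⟩
    rw [MvPolynomial.monomial_mul, one_mul, add_left_comm,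
      add_tsub_cancel_of_le (single_le_of_ne he0)] at h2
    exact h2
  set τ := MvPolynomial.monomial a.1 1 - f a with hτ
  -- The part of the tail violating the claim: the terms with `x_0`-exponent exactly `k`. The aim is
  -- to show that `x_1 σ` is divisible by `x_0^{k+1}`, which forces `σ = 0`.
  set σ : MvPolynomial (Fin (n + 1)) A :=
    ∑ e ∈ τ.support.filter (fun e => e 0 = k), MvPolynomial.monomial e (MvPolynomial.coeff e τ)
    with hσ
  have hτsupp : ∀ e ∈ τ.support, e ∉ monomials J ∧ e.degree = a.1.degree ∧ k ≤ e 0 := by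
    intro e he
    rw [MvPolynomial.mem_support_iff] at he
    obtain ⟨h1, h2⟩ := hms.coeff_sub_ne_zero he
    refine ⟨not_mem_of_mem_sousEscalierDeg_truncation a.2 h1, h1.2,
      ih a hd (by omega) (by omega) e fun h0 => he (h2.trans (by rw [h0, neg_zero]))⟩
  have hx₁τ : MvPolynomial.monomial (Finsupp.single x₁ 1) 1 * τ ∈ reducible I (N (k + 1)) := by
    rw [hτ, mul_sub, MvPolynomial.monomial_mul, one_mul]
    exact Submodule.sub_mem _ (hmon' _ rfl hk) (mem_reducible_of_mem (I.mul_mem_left _ (hfI a)))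
  have hx₁σ : MvPolynomial.monomial (Finsupp.single x₁ 1) 1 * σ ∈ reducible I (N (k + 1)) := by
    have e1 : σ = τ - ∑ e ∈ τ.support.filter (fun e => ¬ e 0 = k),
        MvPolynomial.monomial e (MvPolynomial.coeff e τ) := by
      rw [eq_sub_iff_add_eq, hσ, Finset.sum_filter_add_sum_filter_not, ← MvPolynomial.as_sum]
    rw [e1, mul_sub, Finset.mul_sum]
    refine Submodule.sub_mem _ hx₁τ (Submodule.sum_mem _ fun e he => ?_)
    rw [Finset.mem_filter] at he
    obtain ⟨-, h2, h3⟩ := hτsupp e he.1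
    have h4 := Submodule.smul_mem _ (MvPolynomial.coeff e τ) (hmon' e h2 (by omega))
    rw [MvPolynomial.monomial_mul, one_mul]
    rwa [MvPolynomial.smul_monomial, smul_eq_mul, mul_one] at h4
  obtain ⟨h', h1, h2⟩ := hx₁σ
  have hσcoeff : ∀ e, MvPolynomial.coeff e σ = if e 0 = k then MvPolynomial.coeff e τ else 0 := by
    intro e
    rw [hσ, MvPolynomial.coeff_sum]
    simp only [MvPolynomial.coeff_monomial]
    rw [Finset.sum_ite_eq']
    simp only [Finset.mem_filter, MvPolynomial.mem_support_iff]
    by_cases h0 : e 0 = k <;> by_cases h1 : MvPolynomial.coeff e τ = 0 <;> simp [h0, h1]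
  -- The degree hypothesis for `k + 1` says `ρ + k ≤ m`, which is what keeps `x_1 σ` outside `J`.
  -- The congruence then becomes an equality.
  have h3 := hzero _ h2 fun e he => by
    by_cases he' : MvPolynomial.coeff e h' = 0
    · rw [MvPolynomial.coeff_sub, he', sub_zero, MvPolynomial.coeff_monomial_mul'] at he
      split_ifs at he with hle
      · rw [one_mul, hσcoeff] at he
        split_ifs at he with h0
        · obtain ⟨k1, k2, -⟩ := hτsupp _ (MvPolynomial.mem_support_iff.2 he)
          have := single_one_add_not_mem hJ hs k1 hx₁ (by rw [k2, h0]; omega)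
          rwa [add_tsub_cancel_of_le hle] at this
        · exact absurd rfl he
      · exact absurd rfl he
    · exact (h1 e he').1
  have h4 : MvPolynomial.coeff c τ = MvPolynomial.coeff (Finsupp.single x₁ 1 + c) h' := by
    rw [← sub_eq_zero.1 h3, MvPolynomial.coeff_monomial_mul, one_mul, hσcoeff, if_pos hck]
  have h5 : MvPolynomial.coeff c τ ≠ 0 := by
    rw [hτ, MvPolynomial.coeff_sub, MvPolynomial.coeff_monomial, if_neg (Ne.symm hca), zero_sub]
    exact neg_ne_zero.2 hc
  have h6 := (h1 _ (h4 ▸ h5)).2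
  simp [hx₁0] at h6
  omega

end Truncation

/-! ### Counting parameters and constructing the closed immersion. -/

section Embedding

variable {n : ℕ} {K : Type u} [Field K]

theorem embedsInAffineSpace_of_surjective {R : Type u} [CommRing R] [Algebra K R] {N : ℕ}
    (φ : MvPolynomial (ULift.{u} (Fin N)) K →ₐ[K] R) (hφ : Function.Surjective φ) :
    EmbedsInAffineSpace (Spec.map (CommRingCat.ofHom (algebraMap K R))) N := by
  have hcl : IsClosedImmersion (Spec.map (CommRingCat.ofHom φ.toRingHom)) :=
    IsClosedImmersion.spec_of_surjective _ hφ
  refine ⟨Spec.map (CommRingCat.ofHom φ.toRingHom) ≫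
    (AffineSpace.SpecIso (ULift.{u} (Fin N)) (CommRingCat.of K)).inv, inferInstance, ?_⟩
  rw [Category.assoc, AffineSpace.SpecIso_inv_over, ← Spec.map_comp, ← CommRingCat.ofHom_comp]
  congr 2
  exact φ.comp_algebraMap

theorem finite_sousEscalierDeg (J : Ideal (PolyRing n K)) (d : ℕ) : (sousEscalierDeg J d).Finite := by
  classical
  refine ((Finset.univ : Finset (Fin (n + 1))).finsuppAntidiag d).finite_toSet.subset fun c hc => ?_
  rw [Finset.mem_coe, Finset.mem_finsuppAntidiag]
  exact ⟨by rw [← hc.2, Finsupp.degree_eq_sum], Finset.subset_univ _⟩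

/-- The parameters in the tails of the superminimals, sorted by head term. -/
def smallParamsEquiv (J : Ideal (PolyRing n K)) :
    smallParams J ≃ Σ a : superminimals J, sousEscalierDeg J a.1.degree where
  toFun p := ⟨⟨p.1.1.1, p.2⟩, ⟨p.1.1.2, p.1.2.2⟩⟩
  invFun q := ⟨⟨(q.1.1, q.2.1), q.1.2.1, q.2.2⟩, q.1.2⟩
  left_inv _ := rfl
  right_inv _ := rfl

theorem finite_superminimals (J : Ideal (PolyRing n K)) : (superminimals J).Finite :=
  (monomialBasis_finite J).subset fun _ h => h.1

theorem finite_smallParams (J : Ideal (PolyRing n K)) : (smallParams J).Finite := by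
  have := (finite_superminimals J).to_subtype
  have := fun d => (finite_sousEscalierDeg J d).to_subtype
  exact Set.finite_coe_iff.1 (Finite.of_equiv _ (smallParamsEquiv J).symm)

theorem ncard_smallParams (J : Ideal (PolyRing n K)) :
    (smallParams J).ncard = ∑ᶠ a ∈ superminimals J, (sousEscalierDeg J a.degree).ncard := by
  have := (finite_superminimals J).fintype
  have := fun d => (finite_sousEscalierDeg J d).to_subtype
  rw [← Nat.card_coe_set_eq, Nat.card_congr (smallParamsEquiv J), Nat.card_sigma,
    ← finsum_set_coe_eq_finsum_mem, finsum_eq_sum_of_fintype]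
  simp only [Nat.card_coe_set_eq]

theorem sousEscalierDeg_truncation {J : Ideal (PolyRing n K)} {m : ℤ} {d : ℕ} (h : m ≤ d) :
    sousEscalierDeg (truncation J m) d = sousEscalierDeg J d := by
  ext c
  refine and_congr_left fun hc => not_congr ?_
  exact mem_monomials_truncation.trans (and_iff_left (hc.symm ▸ h))

theorem ncard_smallParams_truncation (J : Ideal (PolyRing n K)) (m : ℤ) :
    (smallParams (truncation J m)).ncard =
      ∑ᶠ a ∈ superminimals (truncation J m), (sousEscalierDeg J a.degree).ncard := by
  rw [ncard_smallParams]
  refine finsum_mem_congr rfl fun a ha => ?_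
  rw [sousEscalierDeg_truncation (mem_monomials_truncation.1 ha.1.1).2]

theorem mk_X_eq_neg_coeff {J : Ideal (PolyRing n K)} (p : Param J) :
    Ideal.Quotient.mk (markedIdeal J) (MvPolynomial.X p) =
      - MvPolynomial.coeff p.1.2 (universalMarked J ⟨p.1.1, p.2.1⟩) := by
  have hne : p.1.1 ≠ p.1.2 := fun h => p.2.2.1 (h ▸ p.2.1.1)
  rw [universalMarked, MvPolynomial.coeff_map, coeff_genericMarked, if_neg hne,
    dif_pos p.2.2, zero_sub, map_neg, neg_neg]

variable {J : Ideal (PolyRing n K)}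

theorem underlineMon_mem_of_mem_smallParams (hm : IsMonomialIdeal J) (hJ : IsStronglyStable J)
    (hs : IsSaturated J) {μ : ℤ} (p : smallParams (truncation J μ)) :
    underlineMon p.1.1.1 ∈ monomialBasis J := by
  have h : underlineMon p.1.1.1 ∈ monomialBasis (underlineIdeal (truncation J μ)) := p.2.2
  rwa [underlineIdeal_truncation hm hJ hs] at h

/-- The coordinate ring of `Mf(J_{≥ m})` is generated by as many elements as there are parameters
in the tails of the superminimals of `J_{≥ ρ - 1}`. -/
theorem exists_surjective (hm : IsMonomialIdeal J) (hJ : IsStronglyStable J)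
    (hs : IsSaturated J) {m : ℤ} (hrho : (rho J : ℤ) - 1 ≤ m) :
    ∃ φ : MvPolynomial (smallParams (truncation J ((rho J : ℤ) - 1))) K →ₐ[K]
      MarkedRing (truncation J m), Function.Surjective φ := by
  set μ : ℤ := (rho J : ℤ) - 1 with hμ
  set Q := truncation J m with hQ
  have hms : IsMarkedSet Q (universalMarked Q) := isMarkedSet_universalMarked
  have hzero : ∀ h ∈ Ideal.span (Set.range (universalMarked Q)),
      (∀ c, MvPolynomial.coeff c h ≠ 0 → c ∉ monomials J) → h = 0 := fun h hI hN =>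
    eq_zero_of_mem_span_universalMarked (hJ.truncation m) hI fun c hc hcJ =>
      hN c hc (mem_monomials_truncation.1 hcJ).1
  -- The parameter with head over `x^b` and tail monomial `x^γ` goes to the coefficient of `x_0^k
  -- x^γ` in the superminimal polynomial over `x^b` in `J_{≥m}`, where `k` is the difference in
  -- degree of the two superminimals.
  let g : smallParams (truncation J μ) → MarkedRing Q := fun p =>
    MvPolynomial.coeff (Finsupp.single 0
        ((superminimalOf m (underlineMon p.1.1.1)).degree - p.1.1.1.degree) + p.1.1.2)
      (universalMarked Q ⟨superminimalOf m (underlineMon p.1.1.1),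
        superminimalOf_mem (underlineMon_mem_of_mem_smallParams hm hJ hs p) m⟩)
  let φ : MvPolynomial (smallParams (truncation J μ)) K →ₐ[K] MarkedRing Q := MvPolynomial.aeval g
  have hall := coeff_mem_of_superminimal hJ hs hms hzero φ.range.toSubring (by
    intro b hb c
    by_cases hc0 : MvPolynomial.coeff c
        (universalMarked Q ⟨superminimalOf m b, superminimalOf_mem hb m⟩) = 0
    · rw [hc0]
      exact Subring.zero_mem _
    by_cases hcs : c = superminimalOf m b
    · subst hcs
      rw [hms.coeff_head ⟨superminimalOf m b, superminimalOf_mem hb m⟩]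
      exact Subring.one_mem _
    have hcN := hms.coeff_tail _ c hcs hc0
    have hcJ := not_mem_of_mem_sousEscalierDeg_truncation (superminimalOf_mem hb m) hcN
    have hcd : c.degree = (superminimalOf m b).degree := hcN.2
    have hdm := degree_superminimalOf m b
    have hdμ := degree_superminimalOf μ b
    have hb0 := monomialBasis_apply_zero hJ hs hb
    obtain ⟨k, hk⟩ : ∃ k, (superminimalOf m b).degree = (superminimalOf μ b).degree + k :=
      Nat.exists_eq_add_of_le (by omega)
    -- If `k > 0` then `m > |b|`, so the superminimal has degree exactly `m`, its `x_0`-exponent `m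
    -- - |b|` is at least `k`, and `ρ - 1 + k ≤ m`.
    have hkc : k ≤ c 0 := by
      by_cases hk0 : k = 0
      · omega
      refine le_apply_zero_of_coeff_ne_zero hJ hs hms hzero k
        ⟨superminimalOf m b, superminimalOf_mem hb m⟩ ?_ ?_ ?_ c hc0
      · change ((superminimalOf m b).degree : ℤ) = m
        omega
      · change k ≤ superminimalOf m b 0
        rw [superminimalOf, Finsupp.add_apply, Finsupp.single_eq_same]
        omega
      · change rho J + k ≤ (superminimalOf m b).degree + 1
        omega
    obtain ⟨γ, rfl⟩ : ∃ γ, c = Finsupp.single 0 k + γ :=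
      exists_add_of_le fun i => by
        classical
        rw [Finsupp.single_apply]
        split_ifs with hi
        · exact hi ▸ hkc
        · exact Nat.zero_le _
    have hγd : γ.degree = (superminimalOf μ b).degree := by
      rw [map_add, Finsupp.degree_single] at hcd
      omega
    have hγ : γ ∈ sousEscalierDeg (truncation J μ) (superminimalOf μ b).degree :=
      ⟨fun h => hcJ (monomials_mono (mem_monomials_truncation.1 h).1 le_add_self), hγd⟩
    have hund := underlineMon_superminimalOf hb0 μ
    let p : smallParams (truncation J μ) :=
      ⟨⟨(superminimalOf μ b, γ), superminimalOf_mem hb μ, hγ⟩, by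
        change superminimalOf μ b ∈ superminimals (truncation J μ)
        rw [superminimals_truncation hm hJ hs]
        exact ⟨b, hb, rfl⟩⟩
    have hpg : g p = MvPolynomial.coeff (Finsupp.single 0 k + γ)
        (universalMarked Q ⟨superminimalOf m b, superminimalOf_mem hb m⟩) := by
      have key : ∀ (b' : Mon n) (hb' : b' ∈ monomialBasis J), b' = b →
          MvPolynomial.coeff (Finsupp.single 0
            ((superminimalOf m b').degree - (superminimalOf μ b).degree) + γ)
            (universalMarked Q ⟨superminimalOf m b', superminimalOf_mem hb' m⟩) =
          MvPolynomial.coeff (Finsupp.single 0 k + γ)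
            (universalMarked Q ⟨superminimalOf m b, superminimalOf_mem hb m⟩) := by
        rintro b' hb' rfl
        rw [hk, add_tsub_cancel_left]
      exact key _ (underlineMon_mem_of_mem_smallParams hm hJ hs p) hund
    rw [← hpg]
    exact ⟨MvPolynomial.X p, MvPolynomial.aeval_X g p⟩)
  refine ⟨φ, fun r => ?_⟩
  obtain ⟨r, rfl⟩ := Ideal.Quotient.mk_surjective r
  change Ideal.Quotient.mk (markedIdeal Q) r ∈ φ.range
  induction r using MvPolynomial.induction_on with
  | C x => exact φ.range.algebraMap_mem x
  | add p q hp hq => rw [map_add]; exact φ.range.add_mem hp hq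
  | mul_X p i hp =>
    rw [map_mul, mk_X_eq_neg_coeff]
    exact φ.range.mul_mem hp (φ.range.neg_mem (hall _ _))

theorem embedsInAffineSpace_truncation (hm : IsMonomialIdeal J) (hJ : IsStronglyStable J)
    (hs : IsSaturated J) {m : ℤ} (hrho : (rho J : ℤ) - 1 ≤ m) :
    EmbedsInAffineSpace (markedSchemeHom (truncation J m))
      (smallParams (truncation J ((rho J : ℤ) - 1))).ncard := by
  obtain ⟨φ, hφ⟩ := exists_surjective hm hJ hs hrho
  have := (finite_smallParams (truncation J ((rho J : ℤ) - 1))).to_subtype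
  let e : ULift.{u} (Fin (smallParams (truncation J ((rho J : ℤ) - 1))).ncard) ≃
      smallParams (truncation J ((rho J : ℤ) - 1)) :=
    Equiv.ulift.trans (Finite.equivFinOfCardEq (Nat.card_coe_set_eq _)).symm
  exact embedsInAffineSpace_of_surjective (φ.comp (MvPolynomial.renameEquiv K e).toAlgHom)
    (hφ.comp (MvPolynomial.renameEquiv K e).surjective)

end Embedding

/-! ### Hilbert function, regularity and the numerical bound. -/

section HilbertFunction

variable {n : ℕ} {K : Type u} [Field K]

theorem IsMonomialIdeal.mem_monomials_of_mem {J : Ideal (PolyRing n K)} (hm : IsMonomialIdeal J)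
    {f : PolyRing n K} (hf : f ∈ J) {c : Mon n} (hc : c ∈ f.support) : c ∈ monomials J := by
  obtain ⟨A, rfl⟩ := hm
  obtain ⟨s, hs, hsc⟩ := MvPolynomial.mem_ideal_span_monomial_image.1 hf c hc
  exact mem_monomials_monomialSpan.2 ⟨s, hs, hsc⟩

/-- The Hilbert function of the quotient by a monomial ideal counts the monomials outside it. -/
theorem hilbertFunction_eq_ncard {J : Ideal (PolyRing n K)} (hm : IsMonomialIdeal J) (t : ℕ) :
    hilbertFunction J t = (sousEscalierDeg J t).ncard := by
  have := (finite_sousEscalierDeg J t).fintype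
  let v : sousEscalierDeg J t → PolyRing n K ⧸ J :=
    fun c => Ideal.Quotient.mkₐ K J (MvPolynomial.monomial c.1 1)
  have hspan : (MvPolynomial.homogeneousSubmodule (Fin (n + 1)) K t).map
      (Ideal.Quotient.mkₐ K J).toLinearMap = Submodule.span K (Set.range v) := by
    refine le_antisymm ?_ (Submodule.span_le.2 ?_)
    · rintro _ ⟨f, hf, rfl⟩
      rw [MvPolynomial.as_sum f, map_sum]
      refine Submodule.sum_mem _ fun c hc => ?_
      have hcd : c.degree = t := by
        have := hf (MvPolynomial.mem_support_iff.1 hc)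
        rw [Finsupp.degree_eq_weight_one]
        exact this
      have e1 : MvPolynomial.monomial c (MvPolynomial.coeff c f) =
          MvPolynomial.coeff c f • (MvPolynomial.monomial c 1 : PolyRing n K) := by
        rw [MvPolynomial.smul_monomial, smul_eq_mul, mul_one]
      rw [e1, map_smul]
      refine Submodule.smul_mem _ _ ?_
      by_cases hcJ : c ∈ monomials J
      · have : (Ideal.Quotient.mkₐ K J).toLinearMap (MvPolynomial.monomial c 1) = 0 :=
          Ideal.Quotient.eq_zero_iff_mem.2 hcJ
        rw [this]
        exact Submodule.zero_mem _
      · exact Submodule.subset_span ⟨⟨c, hcJ, hcd⟩, rfl⟩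
    · rintro _ ⟨c, rfl⟩
      exact ⟨_, MvPolynomial.isHomogeneous_monomial 1 c.2.2, rfl⟩
  have hli : LinearIndependent K v := by
    rw [Fintype.linearIndependent_iff]
    intro g hg c
    classical
    have hmem : ∑ i, g i • (MvPolynomial.monomial i.1 1 : PolyRing n K) ∈ J := by
      rw [← Ideal.Quotient.eq_zero_iff_mem, ← hg]
      change Ideal.Quotient.mkₐ K J _ = _
      rw [map_sum]
      refine Finset.sum_congr rfl fun i _ => ?_
      rw [map_smul]
    by_contra hgc
    refine c.2.1 (hm.mem_monomials_of_mem hmem (MvPolynomial.mem_support_iff.2 ?_))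
    rw [MvPolynomial.coeff_sum, Finset.sum_eq_single c]
    · rwa [MvPolynomial.coeff_smul, MvPolynomial.coeff_monomial, if_pos rfl, smul_eq_mul, mul_one]
    · intro b _ hb
      rw [MvPolynomial.coeff_smul, MvPolynomial.coeff_monomial,
        if_neg fun h => hb (Subtype.ext h), smul_zero]
    · exact fun h => absurd (Finset.mem_univ c) h
  rw [hilbertFunction, hspan, finrank_span_eq_card hli, ← Nat.card_eq_fintype_card,
    Nat.card_coe_set_eq]

open Classical in
/-- The variables that are at most every variable of `x^b`. -/
def lowVars (b : Mon n) : Finset (Fin (n + 1)) := Finset.univ.filter fun i => ∀ j ∈ b.support, i ≤ j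

theorem mem_lowVars {b : Mon n} {i : Fin (n + 1)} : i ∈ lowVars b ↔ ∀ j ∈ b.support, i ≤ j := by
  simp [lowVars]

open Classical in
/-- Counting monomials of degree `t` by the star decomposition. -/
theorem ncard_add_sum_eq {J : Ideal (PolyRing n K)} (hJ : IsStronglyStable J) (B : Finset (Mon n))
    (hB : (B : Set (Mon n)) = monomialBasis J) {t : ℕ} (ht : ∀ b ∈ B, b.degree ≤ t) :
    (sousEscalierDeg J t).ncard + ∑ b ∈ B, ((lowVars b).finsuppAntidiag (t - b.degree)).card =
      ((Finset.univ : Finset (Fin (n + 1))).finsuppAntidiag t).card := by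
  have hB' : ∀ b, b ∈ B ↔ b ∈ monomialBasis J := fun b => by rw [← hB]; rfl
  have hdeg : ∀ (s : Finset (Fin (n + 1))) (d : ℕ) (c : Mon n),
      c ∈ s.finsuppAntidiag d ↔ c.degree = d ∧ c.support ⊆ s := by
    intro s d c
    rw [Finset.mem_finsuppAntidiag]
    refine and_congr_left fun h => ?_
    rw [Finsupp.degree_apply, Finset.sum_subset h fun i _ hi => by simpa using hi]
  have h1 : sousEscalierDeg J t =
      (((Finset.univ : Finset (Fin (n + 1))).finsuppAntidiag t).filter (· ∉ monomials J) :
        Finset (Mon n)) := by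
    ext c
    rw [Finset.mem_coe, Finset.mem_filter, hdeg]
    exact ⟨fun h => ⟨⟨h.2, Finset.subset_univ _⟩, h.1⟩, fun h => ⟨h.2, h.1.1⟩⟩
  rw [h1, Set.ncard_coe_finset, ← Finset.card_sigma, add_comm,
    ← Finset.card_filter_add_card_filter_not (s := Finset.univ.finsuppAntidiag t)
      (· ∈ monomials J)]
  congr 1
  refine Finset.card_bij (fun q _ => q.2 + q.1) ?_ ?_ ?_
  · rintro ⟨b, e⟩ hq
    rw [Finset.mem_sigma, hdeg] at hq
    rw [Finset.mem_filter, hdeg]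
    refine ⟨⟨?_, Finset.subset_univ _⟩, monomials_mono ((hB' b).1 hq.1).1 le_add_self⟩
    have := ht b hq.1
    have := hq.2.1
    dsimp only at this ⊢
    rw [map_add]
    omega
  · rintro ⟨b, e⟩ hq ⟨b', e'⟩ hq' h
    rw [Finset.mem_sigma, hdeg] at hq hq'
    obtain ⟨k1, k2⟩ := Star.unique (fun i hi => mem_lowVars.1 (hq.2.2 hi))
      (fun i hi => mem_lowVars.1 (hq'.2.2 hi)) ((hB' b).1 hq.1) ((hB' b').1 hq'.1) h
    dsimp only at k1 k2
    rw [k1, k2]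
  · intro c hc
    rw [Finset.mem_filter, hdeg] at hc
    obtain ⟨b, hb, e, hs, rfl⟩ := hJ.exists_star hc.2
    refine ⟨⟨b, e⟩, ?_, rfl⟩
    rw [Finset.mem_sigma, hdeg]
    refine ⟨(hB' b).2 hb, ?_, fun i hi => mem_lowVars.2 (hs i hi)⟩
    have := hc.1.1
    rw [map_add] at this
    dsimp only
    omega

theorem card_finsuppAntidiag_eq_eval {s : Finset (Fin (n + 1))} (hs : s.Nonempty) {k t : ℕ}
    (hkt : k ≤ t) : ((s.finsuppAntidiag (t - k)).card : ℚ) =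
      (Polynomial.preHilbertPoly ℚ (s.card - 1) k).eval (t : ℚ) := by
  rw [Polynomial.preHilbertPoly_eq_choose_sub_add _ _ hkt,
    Finset.card_finsuppAntidiag_nat_eq_choose]
  have := hs.card_pos
  have e : s.card + (t - k) - 1 = t - k + (s.card - 1) := by omega
  rw [e, Nat.choose_symm_add]

/-- The Hilbert function of a strongly stable ideal agrees with the Hilbert polynomial from the
maximal degree of a generator on. -/
theorem hilbertPolynomial_eval {J : Ideal (PolyRing n K)} (hm : IsMonomialIdeal J)
    (hJ : IsStronglyStable J) {p : Polynomial ℚ} (hp : IsHilbertPolynomial J p) {t : ℕ}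
    (ht : ∀ b ∈ monomialBasis J, b.degree ≤ t) :
    p.eval (t : ℚ) = ((sousEscalierDeg J t).ncard : ℚ) := by
  set B := (monomialBasis_finite J).toFinset with hBdef
  have hB : (B : Set (Mon n)) = monomialBasis J := Set.Finite.coe_toFinset _
  have hmemB : ∀ b, b ∈ B ↔ b ∈ monomialBasis J := fun b => Set.Finite.mem_toFinset _
  -- The polynomial form of the count: all monomials of degree `t`, minus those of `J` sorted by the
  -- generator in their star decomposition.
  set P : Polynomial ℚ := Polynomial.preHilbertPoly ℚ
      ((Finset.univ : Finset (Fin (n + 1))).card - 1) 0 -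
    ∑ b ∈ B, Polynomial.preHilbertPoly ℚ ((lowVars b).card - 1) b.degree with hP
  have hPeval : ∀ s : ℕ, (∀ b ∈ B, b.degree ≤ s) →
      P.eval (s : ℚ) = ((sousEscalierDeg J s).ncard : ℚ) := by
    intro s hs
    have h1 := congrArg (Nat.cast : ℕ → ℚ) (ncard_add_sum_eq hJ B hB hs)
    -- `x_0` always belongs to `lowVars b`, so this set is nonempty and `card - 1` is not truncated.
    rw [Nat.cast_add, Nat.cast_sum, Finset.sum_congr rfl fun b hb =>
      card_finsuppAntidiag_eq_eval (s := lowVars b)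
        ⟨0, mem_lowVars.2 fun j _ => Fin.zero_le j⟩ (hs b hb)] at h1
    have h2 := card_finsuppAntidiag_eq_eval (Finset.univ_nonempty (α := Fin (n + 1))) (Nat.zero_le s)
    rw [tsub_zero] at h2
    rw [hP, Polynomial.eval_sub, Polynomial.eval_finsetSum, ← h2, ← h1]
    ring
  have hpP : p = P := by
    obtain ⟨s₀, hs₀⟩ := Filter.eventually_atTop.1 hp
    refine Polynomial.eq_of_infinite_eval_eq _ _ ?_
    refine Set.Infinite.mono ?_ ((Set.Ici_infinite (max s₀ t)).image
      (Nat.cast_injective (R := ℚ)).injOn)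
    rintro _ ⟨s, hs, rfl⟩
    have hs' : max s₀ t ≤ s := hs
    have h1 := hs₀ s (by omega)
    have h2 := hPeval s fun b hb => (ht b ((hmemB b).1 hb)).trans (by omega)
    change p.eval (s : ℚ) = P.eval (s : ℚ)
    rw [← h1, h2, hilbertFunction_eq_ncard hm]
  rw [hpP]
  exact hPeval t fun b hb => ht b ((hmemB b).1 hb)

/-- Multiplication by a power of `x_0` is injective and preserves the complement of a saturated
strongly stable ideal. -/
theorem ncard_sousEscalierDeg_mono {J : Ideal (PolyRing n K)} (hJ : IsStronglyStable J)
    (hs : IsSaturated J) {d t : ℕ} (h : d ≤ t) :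
    (sousEscalierDeg J d).ncard ≤ (sousEscalierDeg J t).ncard := by
  refine Set.ncard_le_ncard_of_injOn (fun c => Finsupp.single 0 (t - d) + c) ?_
    (fun _ _ _ _ h => add_left_cancel h) (finite_sousEscalierDeg J t)
  intro c hc
  refine ⟨fun h => hc.1 (mem_of_single_add_mem hJ hs h), ?_⟩
  have := hc.2
  rw [map_add, Finsupp.degree_single]
  omega

/-- Only the first step of the resolution matters. Some homogeneous generator must contain a
monomial dividing `x^b`; this monomial lies in `J`, so by minimality it is `x^b`, whose degree is
thus that of a basis element of `F_0`. -/
theorem IsRegular.degree_le {J : Ideal (PolyRing n K)} (hm : IsMonomialIdeal J) {r : ℤ}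
    (hr : IsRegular J r) {b : Mon n} (hb : b ∈ monomialBasis J) : (b.degree : ℤ) ≤ r := by
  classical
  obtain ⟨rank, deg, ε, d, hres, hdeg⟩ := hr
  have hbJ : MvPolynomial.monomial b (1 : K) ∈ J := hb.1
  rw [← hres.range_eq] at hbJ
  obtain ⟨v, hv⟩ := hbJ
  rw [LinearMap.pi_apply_eq_sum_univ] at hv
  have hcoeff : MvPolynomial.coeff b (∑ i, v i • ε fun j => if i = j then 1 else 0) ≠ 0 := by
    rw [hv, MvPolynomial.coeff_monomial, if_pos rfl]
    exact one_ne_zero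
  rw [MvPolynomial.coeff_sum] at hcoeff
  obtain ⟨i, -, hi⟩ := Finset.exists_ne_zero_of_sum_ne_zero hcoeff
  have hsingle : (fun j => if i = j then (1 : PolyRing n K) else 0) = Pi.single i 1 := by
    ext1 j
    simp [Pi.single_apply, eq_comm]
  rw [hsingle, smul_eq_mul, MvPolynomial.coeff_mul] at hi
  obtain ⟨⟨c₁, c₂⟩, hc, hne⟩ := Finset.exists_ne_zero_of_sum_ne_zero hi
  rw [Finset.HasAntidiagonal.mem_antidiagonal] at hc
  have hc₂ : c₂ ∈ (ε (Pi.single i 1)).support :=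
    MvPolynomial.mem_support_iff.2 (right_ne_zero_of_mul hne)
  have hc₂J : c₂ ∈ monomials J :=
    hm.mem_monomials_of_mem (hres.range_eq ▸ LinearMap.mem_range_self ε _) hc₂
  have heq := monomialBasis_eq_of_le hc₂J hb (hc ▸ le_add_self)
  rw [← heq, hres.homogeneous_aug i c₂ hc₂]
  simpa using hdeg 0 i

/-- The superminimal over `x^b` has degree `max (ρ - 1) |b|`, which is at most `r`, so each of the
`|B_J|` summands is at most `|N(J)_r| = p(r)`. -/
theorem ncard_smallParams_le {J : Ideal (PolyRing n K)} (hm : IsMonomialIdeal J)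
    (hJ : IsStronglyStable J) (hs : IsSaturated J) {p : Polynomial ℚ} {r : ℤ}
    (hp : IsHilbertPolynomial J p) (hr : IsRegular J r) :
    ((smallParams (truncation J ((rho J : ℤ) - 1))).ncard : ℚ) ≤
      ((monomialBasis J).ncard : ℚ) * p.eval (r : ℚ) := by
  set μ : ℤ := (rho J : ℤ) - 1 with hμ
  have hdeg : ∀ b ∈ monomialBasis J, (b.degree : ℤ) ≤ r := fun b hb => hr.degree_le hm hb
  -- A generator is needed to know that `r` is nonnegative; without generators both sides are zero.
  rcases (monomialBasis J).eq_empty_or_nonempty with hB | ⟨b₀, hb₀⟩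
  · rw [ncard_smallParams_truncation, superminimals_truncation hm hJ hs, hB]
    simp
  obtain ⟨t, rfl⟩ : ∃ t : ℕ, r = t := Int.eq_ofNat_of_zero_le (by have := hdeg b₀ hb₀; omega)
  have hdegt : ∀ b ∈ monomialBasis J, b.degree ≤ t := fun b hb => by
    have := hdeg b hb
    omega
  have hrho : rho J ≤ t := by
    refine csSup_le' ?_
    rintro _ ⟨b, hb, -, rfl⟩
    exact hdegt b hb
  rw [Int.cast_natCast, hilbertPolynomial_eval hm hJ hp hdegt, ← Nat.cast_mul, Nat.cast_le,
    ncard_smallParams_truncation, superminimals_truncation hm hJ hs,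
    finsum_mem_image (superminimalOf_injOn hJ hs μ),
    finsum_mem_eq_finite_toFinset_sum _ (monomialBasis_finite J),
    Set.ncard_eq_toFinset_card _ (monomialBasis_finite J), ← smul_eq_mul]
  refine Finset.sum_le_card_nsmul _ _ _ fun b hb => ?_
  rw [Set.Finite.mem_toFinset] at hb
  refine ncard_sousEscalierDeg_mono hJ hs ?_
  have := degree_superminimalOf μ b
  have := hdegt b hb
  omega

end HilbertFunction

end MarkedFamily

end

theorem corollary5p9 (n : ℕ) (K : Type u) [Field K] [IsAlgClosed K]
    (J : Ideal (MarkedFamily.PolyRing n K))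
    (hmon : MarkedFamily.IsMonomialIdeal J)
    (hstable : MarkedFamily.IsStronglyStable J)
    (hsat : MarkedFamily.IsSaturated J)
    (T : Ideal (MarkedFamily.PolyRing n K))
    (hT : T = MarkedFamily.truncation J ((MarkedFamily.rho J : ℤ) - 1)) :
    (MarkedFamily.superminimals T).Finite ∧
    (MarkedFamily.smallParams T).Finite ∧
    (∀ m : ℤ, (MarkedFamily.rho J : ℤ) - 1 ≤ m →
      MarkedFamily.EmbedsInAffineSpace
        (MarkedFamily.markedSchemeHom (MarkedFamily.truncation J m))
        (MarkedFamily.smallParams T).ncard) ∧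
    (MarkedFamily.smallParams T).ncard =
      ∑ᶠ a ∈ MarkedFamily.superminimals T,
        (MarkedFamily.sousEscalierDeg J a.degree).ncard ∧
    (∀ (p : Polynomial ℚ) (r : ℤ),
      MarkedFamily.IsHilbertPolynomial J p → MarkedFamily.IsRegularity J r →
      ((MarkedFamily.smallParams T).ncard : ℚ) ≤
        ((MarkedFamily.monomialBasis J).ncard : ℚ) * p.eval (r : ℚ)) := by
  subst hT
  exact ⟨MarkedFamily.finite_superminimals _, MarkedFamily.finite_smallParams _,
    fun m hm => MarkedFamily.embedsInAffineSpace_truncation hmon hstable hsat hm,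
    MarkedFamily.ncard_smallParams_truncation J _,
    fun p r hp hr => MarkedFamily.ncard_smallParams_le hmon hstable hsat hp hr.1⟩
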